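/- **Conventions.** A map $q\colon X\to Y$ of metric spaces is $(L,C)$-coarse Lipschitz if $d(q(x),q(x'))\le L\,d(x,x')+C$ for all $x,x'$. It is a quasi-isometry if, for some $L,C,A$, it is $(L,C)$-coarse Lipschitz and there is an $(L,A)$-coarse Lipschitz map $\bar q\colon Y\to X$ with $d(\bar q q(x),x)\le C$ and $d(q\bar q(y),y)\le C$ for all $x\in X$, $y\in Y$. It is a quasi-isometric map if $q\colon X\to q(X)$ is a quasi-isometry. For $C\subseteq X$ let $C^{+\mu}$ be the open $\mu$-neighbourhood of $C$. $\mathsf{QPMet}$ is the category whose objects are pairs $(X,C)$ of a metric space $X$ and a non-empty subset $C\subseteq X$, and whose morphisms $(X,C)\to(Y,D)$ are the quasi-isometric maps $f\colon X\to Y$ with $D\subseteq f(C)^{+r}$ for some $r\ge 0$; composition is composition of maps. For $\sigma\ge 0$ and $Z\subseteq X$, the $\sigma$-components of $Z$ are the classes of points of $Z$ that can be joined by a finite sequence in $Z$ with consecutive distances $\le\sigma$; let $\mathcal C_\infty(Z,\sigma)$ be the set of unbounded $\sigma$-components. Put $$\mathrm{Ends}(X,C,\sigma)=\varprojlim_{\mu\ge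 0}\mathcal C_\infty(X- C^{+\mu},\sigma),\qquad \mathrm{Ends}(X,C)=\varinjlim_{\sigma\ge 0}\mathrm{Ends}(X,C,\sigma),$$ where all transition functions send a component to the unique component containing it. Thus an element of $\mathrm{Ends}(X,C,\sigma)$ is a family $(A_\mu)_{\mu\ge0}$ with $A_\mu\in\mathcal C_\infty(X-C^{+\mu},\sigma)$ and $A_\nu\subseteq A_\mu$ for $\mu\le\nu$. **Theorem.** The assignment $(X,C)\mapsto \mathrm{Ends}(X,C)$ extends to a covariant functor $\mathrm{Ends}\colon\mathsf{QPMet}\to\mathsf{Sets}$, where $\mathrm{Ends}(f)$ is the function induced by $f$ on components: for every morphism $f\colon (X,C)\to(Y,D)$ and every $(A_\mu)\in \mathrm{Ends}(X,C,\sigma)$ there are $\tau\geq 0$ and $(B_\nu)\in\mathrm{Ends}(Y,D,\tau)$ such that $\mathrm{Ends}(f)[(A_\mu)]=[(B_\nu)]$ and for every $\nu\ge 0$ there is $\mu\ge 0$ with $f(A_\mu)\subseteq B_\nu$. This functor has the following properties. 1. If $f\colon(X,C)\to(X,C)$ is a morphism and there is $r$ with $d(f(x),x)\le r$ for all $x\in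 X$, then $\mathrm{Ends}(f)$ is the identity. 2. Let $(X,C)$ and $(Y,D)$ be objects of $\mathsf{QPMet}$. If $f\colon X\to Y$ is a quasi-isometry and the Hausdorff distance between $f(C)$ and $D$ is finite, then $f$ is a morphism $(X,C)\to(Y,D)$ and $\mathrm{Ends}(f)\colon\mathrm{Ends}(X,C)\to\mathrm{Ends}(Y,D)$ is a bijection. 3. Let $X$ be a proper geodesic metric space and $C\subseteq X$ a non-empty compact subset. Let $\mathsf{Ends}(X)$ be the usual set of ends: classes of proper rays (continuous maps $[0,\infty)\to X$ for which preimages of compact sets are compact), where $\rho_1\sim\rho_2$ if for every compact $K\subseteq X$ there is $N$ such that $\rho_1([N,\infty))$ and $\rho_2([N,\infty))$ lie in the same path component of $X-K$. Then there is a natural bijection $\Phi\colon\mathrm{Ends}(X,C)\to\mathsf{Ends}(X)$, in the sense that $\Phi[(A_\mu)]=[\rho]$ if and only if for every $\mu\ge0$ one has $\rho(t)\in A_\mu$ for all sufficiently large $t$. 4. Let $G$ be a group with a finite generating set, $X$ its Cayley graph (the geometric realization, with the combinatorial path metric), and $P\le G$ a finitely generated subgroup. Let $\mathscr S_0(P)$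 be the collection of non-empty connected $P$-invariant subgraphs of $X$ with compact quotient under $P$; for $A\in\mathscr S_0(P)$ let $\mathscr C_\infty(A)$ be the set of connected components of $X-A$ that are not contained in any element of $\mathscr S_0(P)$. Then the cardinality of $\mathrm{Ends}(X,P)$ equals Bowditch's number of coends of $(G,P)$, that is, the cardinality of $\varprojlim_{A\in\mathscr S_0(P)}\mathscr C_\infty(A)$, where for $A\subseteq B$ the transition function sends a component of $X-B$ to the component of $X-A$ containing it. -/

import Mathlib

open scoped NNReal
open Set

universe u

noncomputable section

/-! ### Coarsely Lipschitz maps, quasi-isometries, quasi-isometric maps -/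

section QuasiIsometry

variable {X Y Z : Type*} [MetricSpace X] [MetricSpace Y] [MetricSpace Z]

/-- `q` is `(L, C)`-coarse Lipschitz. -/
def IsCoarseLipschitz (L C : ℝ) (q : X → Y) : Prop :=
  ∀ x y, dist (q x) (q y) ≤ L * dist x y + C

/-- `q` is an `(L, C)`-quasi-isometry: it is coarse Lipschitz and has a coarse Lipschitz
quasi-inverse. -/
def IsQuasiIsometryWith (L C : ℝ) (q : X → Y) : Prop :=
  IsCoarseLipschitz L C q ∧
    ∃ q' : Y → X, (∃ A : ℝ, IsCoarseLipschitz L A q') ∧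
      (∀ x, dist (q' (q x)) x ≤ C) ∧ (∀ y, dist (q (q' y)) y ≤ C)

/-- `q` is a quasi-isometry (for some constants). -/
def IsQuasiIsometry (q : X → Y) : Prop := ∃ L C : ℝ, IsQuasiIsometryWith L C q

/-- `q` is a quasi-isometric map: it is a quasi-isometry onto its image. -/
def IsQuasiIsometricMap (q : X → Y) : Prop := IsQuasiIsometry (Set.rangeFactorization q)

/-- A quasi-isometric map is the same as a map satisfying two-sided coarse inequalities. -/
theorem isQuasiIsometricMap_iff (q : X → Y) :
    IsQuasiIsometricMap q ↔ ∃ K : ℝ, 0 ≤ K ∧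
      ∀ x y, dist (q x) (q y) ≤ K * dist x y + K ∧ dist x y ≤ K * dist (q x) (q y) + K := by
  constructor
  · rintro ⟨L, C, h1, q', ⟨A, h2⟩, h3, -⟩
    refine ⟨|L| + |A| + 2 * |C|, by positivity, fun x y => ⟨?_, ?_⟩⟩
    · have h := h1 x y
      have hd : dist (q x) (q y) ≤ L * dist x y + C := h
      nlinarith [le_abs_self L, le_abs_self C, abs_nonneg A, abs_nonneg C,
        dist_nonneg (x := x) (y := y), mul_nonneg (sub_nonneg.2 (le_abs_self L))
          (dist_nonneg (x := x) (y := y)), mul_nonneg (abs_nonneg A)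
          (dist_nonneg (x := x) (y := y)), mul_nonneg (abs_nonneg C)
          (dist_nonneg (x := x) (y := y)), abs_nonneg L]
    · have h : dist (q' (rangeFactorization q x)) (q' (rangeFactorization q y))
        ≤ L * dist (q x) (q y) + A := h2 _ _
      have hx := h3 x
      have hy := h3 y
      have ht := dist_triangle4 x (q' (rangeFactorization q x)) (q' (rangeFactorization q y)) y
      rw [dist_comm x (q' _)] at ht
      nlinarith [le_abs_self A, le_abs_self C, abs_nonneg A, abs_nonneg C,
        mul_nonneg (sub_nonneg.2 (le_abs_self L))
          (dist_nonneg (x := q x) (y := q y)), mul_nonneg (abs_nonneg A)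
          (dist_nonneg (x := q x) (y := q y)), mul_nonneg (abs_nonneg C)
          (dist_nonneg (x := q x) (y := q y)), abs_nonneg L]
  · rintro ⟨K, hK, h⟩
    have hs : ∀ y : range q, ∃ x, rangeFactorization q x = y := rangeFactorization_surjective
    choose s hs using hs
    refine ⟨K, K, fun x y => (h x y).1, s, ⟨K, fun y z => ?_⟩, fun x => ?_, fun y => ?_⟩
    · have := (h (s y) (s z)).2
      have e : dist (q (s y)) (q (s z)) = dist y z := by
        rw [← hs y, ← hs z, hs, hs]; rw [Subtype.dist_eq, ← hs y, ← hs z, hs, hs]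
        have h1 : q (s y) = y := congrArg Subtype.val (hs y)
        have h2 : q (s z) = z := congrArg Subtype.val (hs z)
        rw [h1, h2]
      rwa [e] at this
    · have h1 : q (s (rangeFactorization q x)) = q x := congrArg Subtype.val (hs _)
      have := (h (s (rangeFactorization q x)) x).2
      rwa [h1, dist_self, mul_zero, zero_add] at this
    · rw [hs, dist_self]; exact hK

theorem IsQuasiIsometricMap.id : IsQuasiIsometricMap (fun x : X => x) :=
  (isQuasiIsometricMap_iff _).2 ⟨1, zero_le_one, fun x y => by constructor <;> linarith⟩

theorem IsQuasiIsometricMap.comp {g : Y → Z} {f : X → Y} (hg : IsQuasiIsometricMap g)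
    (hf : IsQuasiIsometricMap f) : IsQuasiIsometricMap (fun x => g (f x)) := by
  rw [isQuasiIsometricMap_iff] at *
  obtain ⟨K, hK, h⟩ := hf
  obtain ⟨M, hM, k⟩ := hg
  refine ⟨K * M + K + M, by positivity, fun x y => ?_⟩
  obtain ⟨h1, h2⟩ := h x y
  obtain ⟨k1, k2⟩ := k (f x) (f y)
  have a := mul_le_mul_of_nonneg_left h1 hM
  have b := mul_le_mul_of_nonneg_left k2 hK
  have c := mul_nonneg hK (dist_nonneg (x := x) (y := y))
  have d := mul_nonneg hM (dist_nonneg (x := x) (y := y))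
  have e := mul_nonneg hK (dist_nonneg (x := g (f x)) (y := g (f y)))
  have f := mul_nonneg hM (dist_nonneg (x := g (f x)) (y := g (f y)))
  constructor <;> nlinarith

end QuasiIsometry

/-! ### Filtered ends -/

section FilteredEnds

variable {X : Type u} [MetricSpace X]

/-- There is a `σ`-quasi-path from `x` to `y` inside `Z`
(for `x = y` the path of length zero is allowed). -/
def CoarselyJoined (Z : Set X) (σ : ℝ≥0) : X → X → Prop :=
  Relation.ReflTransGen (fun x y => x ∈ Z ∧ y ∈ Z ∧ dist x y ≤ σ)

/-- The `σ`-coarsely connected component of `x` in `Z` (for `x ∈ Z`). -/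
def coarseComponent (Z : Set X) (σ : ℝ≥0) (x : X) : Set X :=
  {y | y ∈ Z ∧ CoarselyJoined Z σ x y}

/-- The collection of unbounded `σ`-coarsely connected components of `Z`. -/
def unboundedComponents (Z : Set X) (σ : ℝ≥0) : Set (Set X) :=
  {A | (∃ x ∈ Z, A = coarseComponent Z σ x) ∧ ¬ Bornology.IsBounded A}

/-- The complement of the open `μ`-neighbourhood of `C`. -/
def outside (C : Set X) (μ : ℝ≥0) : Set X := (Metric.thickening (μ : ℝ) C)ᶜ

/-- The filtered ends of `(X, C)` at scale `σ`: the inverse limit over `μ` of the sets of unbounded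
`σ`-coarsely connected components of the complement of the open `μ`-neighbourhood of `C`.
As components are pairwise disjoint, the transition function from `ν` to `μ ≤ ν` maps `B` to
`A` exactly when `B ⊆ A`. -/
@[ext]
structure EndsAtScale (C : Set X) (σ : ℝ≥0) : Type u where
  comp : ℝ≥0 → Set X
  mem : ∀ μ, comp μ ∈ unboundedComponents (outside C μ) σ
  anti : ∀ μ ν, μ ≤ ν → comp ν ⊆ comp μ

theorem CoarselyJoined.mono {Z W : Set X} {σ τ : ℝ≥0} (hZ : Z ⊆ W) (h : σ ≤ τ) {x y : X}
    (hxy : CoarselyJoined Z σ x y) : CoarselyJoined W τ x y :=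
  Relation.ReflTransGen.mono (r := fun x y => x ∈ Z ∧ y ∈ Z ∧ dist x y ≤ σ)
    (fun _ _ ⟨h1, h2, h3⟩ => ⟨hZ h1, hZ h2, h3.trans (NNReal.coe_le_coe.2 h)⟩) _ _ hxy

theorem CoarselyJoined.symm {Z : Set X} {σ : ℝ≥0} {x y : X}
    (hxy : CoarselyJoined Z σ x y) : CoarselyJoined Z σ y x := by
  induction hxy with
  | refl => exact .refl
  | tail _ h ih => exact .head ⟨h.2.1, h.1, by rw [dist_comm]; exact h.2.2⟩ ih

theorem coarseComponent_eq {Z : Set X} {σ : ℝ≥0} {x y : X}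
    (h : CoarselyJoined Z σ x y) : coarseComponent Z σ x = coarseComponent Z σ y := by
  ext z
  exact ⟨fun hz => ⟨hz.1, h.symm.trans hz.2⟩, fun hz => ⟨hz.1, h.trans hz.2⟩⟩

theorem outside_anti (C : Set X) {μ ν : ℝ≥0} (h : μ ≤ ν) : outside C ν ⊆ outside C μ :=
  compl_subset_compl.2 (Metric.thickening_mono (NNReal.coe_le_coe.2 h) C)

/-- The union of the `τ`-components of `Z` meeting `A`. -/
def coarseHull (Z : Set X) (τ : ℝ≥0) (A : Set X) : Set X :=
  {y | ∃ x ∈ A, y ∈ coarseComponent Z τ x}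

theorem coarseHull_component {Z : Set X} {σ τ : ℝ≥0} (h : σ ≤ τ) {x : X} (hx : x ∈ Z) :
    coarseHull Z τ (coarseComponent Z σ x) = coarseComponent Z τ x := by
  ext y
  constructor
  · rintro ⟨z, hz, hy⟩
    exact ⟨hy.1, (hz.2.mono subset_rfl h).trans hy.2⟩
  · intro hy
    exact ⟨x, ⟨hx, .refl⟩, hy⟩

namespace EndsAtScale

variable {C : Set X}

/-- The transition function between scales: it sends a component to the unique component at the
larger scale containing it. -/
def transition {σ τ : ℝ≥0} (h : σ ≤ τ) (A : EndsAtScale C σ) : EndsAtScale C τ where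
  comp μ := coarseHull (outside C μ) τ (A.comp μ)
  mem μ := by
    obtain ⟨⟨x, hx, hA⟩, hb⟩ := A.mem μ
    refine ⟨⟨x, hx, by rw [hA, coarseHull_component h hx]⟩, fun hb' => hb (hb'.subset ?_)⟩
    intro y hy
    exact ⟨y, hy, by rw [hA] at hy; exact hy.1, .refl⟩
  anti μ ν hμν := by
    rintro y ⟨x, hx, hy⟩
    exact ⟨x, A.anti μ ν hμν hx, outside_anti C hμν hy.1,
      hy.2.mono (outside_anti C hμν) le_rfl⟩

theorem transition_self {σ : ℝ≥0} (A : EndsAtScale C σ) : transition le_rfl A = A := by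
  apply EndsAtScale.ext
  funext μ
  obtain ⟨⟨x, hx, hA⟩, -⟩ := A.mem μ
  change coarseHull _ _ _ = _
  rw [hA, coarseHull_component le_rfl hx]

theorem transition_transition {σ τ κ : ℝ≥0} (h : σ ≤ τ) (h' : τ ≤ κ) (A : EndsAtScale C σ) :
    transition h' (transition h A) = transition (h.trans h') A := by
  apply EndsAtScale.ext
  funext μ
  obtain ⟨⟨x, hx, hA⟩, -⟩ := A.mem μ
  change coarseHull _ _ (coarseHull _ _ _) = coarseHull _ _ _
  rw [hA, coarseHull_component h hx, coarseHull_component h' hx,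
    coarseHull_component (h.trans h') hx]

end EndsAtScale

/-- Two ends, possibly at different scales, are identified in the direct limit if they become equal
at some larger scale. -/
def FilteredEnds.setoid (C : Set X) : Setoid (Σ σ : ℝ≥0, EndsAtScale C σ) where
  r a b := ∃ (τ : ℝ≥0) (ha : a.1 ≤ τ) (hb : b.1 ≤ τ),
    EndsAtScale.transition ha a.2 = EndsAtScale.transition hb b.2
  iseqv :=
    { refl := fun a => ⟨a.1, le_rfl, le_rfl, rfl⟩
      symm := fun ⟨τ, ha, hb, h⟩ => ⟨τ, hb, ha, h.symm⟩
      trans := fun {a b c} ⟨τ, ha, hb, h⟩ ⟨κ, hb', hc, h'⟩ =>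
        ⟨max τ κ, ha.trans (le_max_left _ _), hc.trans (le_max_right _ _), by
          rw [← EndsAtScale.transition_transition ha (le_max_left _ _), h,
            EndsAtScale.transition_transition,
            ← EndsAtScale.transition_transition hc (le_max_right _ _), ← h',
            EndsAtScale.transition_transition]⟩ }

/-- The set of filtered ends of the pair `(X, C)`: the direct limit over the scale `σ ∈ [0, ∞)`
of the filtered ends at scale `σ`. -/
def FilteredEnds (C : Set X) : Type u := Quotient (FilteredEnds.setoid C)

/-- The canonical map from the ends at scale `σ` to the direct limit. -/
def FilteredEnds.mk {C : Set X} {σ : ℝ≥0} (A : EndsAtScale C σ) : FilteredEnds C :=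
  Quotient.mk _ ⟨σ, A⟩

end FilteredEnds

/-! ### The category of metric pairs -/

/-- A metric space together with a non-empty subspace. -/
structure QPMet : Type (u + 1) where
  carrier : Type u
  [metric : MetricSpace carrier]
  sub : Set carrier
  nonempty : sub.Nonempty

namespace QPMet

attribute [instance] QPMet.metric

/-- `f` is a morphism of pairs `(X, C) → (Y, D)`: a quasi-isometric map such that `D` is contained
in some neighbourhood of `f(C)`. -/
def IsMorphism (P Q : QPMet.{u}) (f : P.carrier → Q.carrier) : Prop :=
  IsQuasiIsometricMap f ∧ ∃ r : ℝ, 0 ≤ r ∧ Q.sub ⊆ Metric.thickening r (f '' P.sub)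

/-- Morphisms of pairs. -/
@[ext]
structure Hom (P Q : QPMet.{u}) : Type u where
  toFun : P.carrier → Q.carrier
  isMorphism : IsMorphism P Q toFun

theorem isMorphism_id (P : QPMet.{u}) : IsMorphism P P (fun x => x) :=
  ⟨.id, 1, zero_le_one, by
    simpa using Metric.self_subset_thickening one_pos P.sub⟩

theorem IsMorphism.comp {P Q R : QPMet.{u}} {g : Q.carrier → R.carrier} {f : P.carrier → Q.carrier}
    (hg : IsMorphism Q R g) (hf : IsMorphism P Q f) : IsMorphism P R (fun x => g (f x)) := by
  refine ⟨hg.1.comp hf.1, ?_⟩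
  obtain ⟨K, hK, k⟩ := (isQuasiIsometricMap_iff g).1 hg.1
  obtain ⟨r, hr, h⟩ := hf.2
  obtain ⟨s, hs, h'⟩ := hg.2
  refine ⟨s + (K * r + K), by positivity, fun z hz => ?_⟩
  obtain ⟨_, ⟨y, hy, rfl⟩, hzy⟩ := Metric.mem_thickening_iff.1 (h' hz)
  obtain ⟨_, ⟨x, hx, rfl⟩, hyx⟩ := Metric.mem_thickening_iff.1 (h hy)
  refine Metric.mem_thickening_iff.2 ⟨g (f x), ⟨x, hx, rfl⟩, ?_⟩
  have h1 := (k y (f x)).1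
  have h2 := mul_le_mul_of_nonneg_left hyx.le hK
  have h3 := dist_triangle z (g y) (g (f x))
  linarith

instance : CategoryTheory.Category.{u} QPMet.{u} where
  Hom := Hom
  id P := ⟨fun x => x, isMorphism_id P⟩
  comp f g := ⟨fun x => g.toFun (f.toFun x), g.isMorphism.comp f.isMorphism⟩

/-- The set of filtered ends of an object. -/
abbrev Ends (P : QPMet.{u}) : Type u := FilteredEnds P.sub

end QPMet

open CategoryTheory in
/-- For a functor `E` that is `(X, C) ↦ Ends (X, C)` on objects, the function
`Ends (X, C) → Ends (Y, D)` that it assigns to a morphism. -/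
def endsMap (E : QPMet.{u} ⥤ Type u) (hE : ∀ P, E.obj P = P.Ends) {P Q : QPMet.{u}} (f : P ⟶ Q)
    (x : P.Ends) : Q.Ends :=
  cast (hE Q) (E.map f (cast (hE P).symm x))

/-! ### The usual space of ends -/

/-- `X` is a geodesic metric space. -/
def IsGeodesicSpace (X : Type*) [MetricSpace X] : Prop :=
  ∀ x y : X, ∃ γ : ℝ → X, γ 0 = x ∧ γ (dist x y) = y ∧
    ∀ s ∈ Icc 0 (dist x y), ∀ t ∈ Icc 0 (dist x y), dist (γ s) (γ t) = |s - t|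

/-- A proper ray: a continuous map `[0, ∞) → X` such that preimages of compact sets are compact. -/
structure ProperRay (X : Type u) [TopologicalSpace X] : Type u where
  toFun : ℝ≥0 → X
  continuous : Continuous toFun
  proper : ∀ K : Set X, IsCompact K → IsCompact (toFun ⁻¹' K)

/-- Two proper rays converge to the same end if for every compact `K` there is `N` such that
their restrictions to `[N, ∞)` lie in the same path component of the complement of `K`. -/
def ProperRay.SameEnd {X : Type u} [TopologicalSpace X] (r s : ProperRay X) : Prop :=
  ∀ K : Set X, IsCompact K → ∃ N : ℕ, ∀ a b : ℝ≥0, (N : ℝ≥0) ≤ a → (N : ℝ≥0) ≤ b →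
    JoinedIn Kᶜ (r.toFun a) (s.toFun b)

theorem ProperRay.SameEnd.refl {X : Type u} [TopologicalSpace X] (r : ProperRay X) :
    r.SameEnd r := by
  intro K hK
  obtain ⟨B, hB⟩ := (r.proper K hK).bddAbove
  obtain ⟨N, hN⟩ := exists_nat_gt B
  refine ⟨N, fun a b ha hb => ?_⟩
  have hpc : IsPathConnected ((fun t : ℝ => r.toFun t.toNNReal) '' Ici (N : ℝ)) :=
    ((convex_Ici (N : ℝ)).isPathConnected nonempty_Ici).image
      (r.continuous.comp continuous_real_toNNReal)
  have hsub : ((fun t : ℝ => r.toFun t.toNNReal) '' Ici (N : ℝ)) ⊆ Kᶜ := by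
    rintro _ ⟨t, ht, rfl⟩ hmem
    have h1 : t.toNNReal ≤ B := hB hmem
    have h2 : (N : ℝ≥0) ≤ t.toNNReal := by
      rw [← NNReal.coe_le_coe, Real.coe_toNNReal t ((Nat.cast_nonneg N).trans ht)]
      exact_mod_cast ht
    exact absurd (h2.trans h1) (not_le.2 hN)
  refine (hpc.joinedIn _ ⟨a, ?_, ?_⟩ _ ⟨b, ?_, ?_⟩).mono hsub
  · exact_mod_cast ha
  · simp
  · exact_mod_cast hb
  · simp

/-- Convergence to the same end is an equivalence relation. -/
def ProperRay.setoid (X : Type u) [TopologicalSpace X] : Setoid (ProperRay X) where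
  r := ProperRay.SameEnd
  iseqv :=
    { refl := ProperRay.SameEnd.refl
      symm := fun h K hK => by
        obtain ⟨N, hN⟩ := h K hK
        exact ⟨N, fun a b ha hb => (hN b a hb ha).symm⟩
      trans := fun h h' K hK => by
        obtain ⟨N, hN⟩ := h K hK
        obtain ⟨M, hM⟩ := h' K hK
        refine ⟨max N M, fun a b ha hb => ?_⟩
        have hmax : ((max N M : ℕ) : ℝ≥0) = max (N : ℝ≥0) (M : ℝ≥0) := Nat.cast_max ..
        rw [hmax] at ha hb
        exact (hN a b ((le_max_left _ _).trans ha) ((le_max_left _ _).trans hb)).trans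
          (hM b b ((le_max_right _ _).trans hb) ((le_max_right _ _).trans hb)) }

/-- The usual set of ends of `X`: classes of proper rays. -/
def RayEnds (X : Type u) [TopologicalSpace X] : Type u := Quotient (ProperRay.setoid X)

/-- The end to which a proper ray converges. -/
def RayEnds.mk {X : Type u} [TopologicalSpace X] (r : ProperRay X) : RayEnds X :=
  Quotient.mk _ r

/-! ### Geometric realization of a graph, with the combinatorial path metric -/

/-- The closed edge between `u` and `v` in barycentric coordinates. -/
def closedEdge {V : Type u} (u v : V) : Set (V →₀ ℝ) :=
  segment ℝ (Finsupp.single u 1) (Finsupp.single v 1)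

/-- The points of the geometric realization of the graph `Γ`, in barycentric coordinates: the
vertices (`u = v`) and the points on the edges. -/
@[ext]
structure GraphRealization {V : Type u} (Γ : SimpleGraph V) : Type u where
  coord : V →₀ ℝ
  mem : ∃ u v, (u = v ∨ Γ.Adj u v) ∧ coord ∈ closedEdge u v

namespace GraphRealization

variable {V : Type u} {Γ : SimpleGraph V}

/-- A vertex as a point of the realization. -/
def vertex (Γ : SimpleGraph V) (v : V) : GraphRealization Γ :=
  ⟨Finsupp.single v 1, v, v, Or.inl rfl, left_mem_segment ℝ _ _⟩

/-- `PathOfLength x y ℓ`: there is a path of length `ℓ` from `x` to `y` which is a concatenation of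
finitely many segments, each inside a closed edge. Every edge is identified with the unit interval
by the coordinate of either of its endpoints. -/
inductive PathOfLength : GraphRealization Γ → GraphRealization Γ → ℝ → Prop
  | nil (x : GraphRealization Γ) : PathOfLength x x 0
  | cons {x y z : GraphRealization Γ} {u v : V} {l : ℝ} : Γ.Adj u v →
      x.coord ∈ closedEdge u v → y.coord ∈ closedEdge u v → PathOfLength y z l →
      PathOfLength x z (|x.coord u - y.coord u| + l)

/-- The combinatorial path metric: the infimum of the lengths of the paths joining two points. -/
def pathDist (x y : GraphRealization Γ) : ℝ := sInf {l | PathOfLength x y l}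

theorem PathOfLength.nonneg {x y : GraphRealization Γ} {l : ℝ} (h : PathOfLength x y l) :
    0 ≤ l := by
  induction h with
  | nil => exact le_rfl
  | cons _ _ _ _ ih => positivity

theorem PathOfLength.trans {x y z : GraphRealization Γ} {l m : ℝ} (h : PathOfLength x y l)
    (h' : PathOfLength y z m) : PathOfLength x z (l + m) := by
  induction h with
  | nil => simpa using h'
  | cons a b c _ ih => rw [add_assoc]; exact .cons a b c (ih h')

theorem PathOfLength.symm {x y : GraphRealization Γ} {l : ℝ} (h : PathOfLength x y l) :
    PathOfLength y x l := by
  induction h with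
  | nil x => exact .nil x
  | @cons x y z u v l a b c _ ih =>
    have := ih.trans (.cons a c b (.nil x))
    rwa [add_zero, abs_sub_comm, add_comm] at this

theorem coord_closedEdge {x : V →₀ ℝ} {u v : V} (huv : u ≠ v) (hx : x ∈ closedEdge u v) :
    x u + x v = 1 ∧ ∀ w, w ≠ u → w ≠ v → x w = 0 := by
  classical
  obtain ⟨a, b, -, -, hab, rfl⟩ := hx
  refine ⟨?_, fun w hu hv => ?_⟩
  · simp [huv, huv.symm, hab]
  · simp [hu.symm, hv.symm]

theorem PathOfLength.coord_le {x y : GraphRealization Γ} {l : ℝ} (h : PathOfLength x y l) (w : V) :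
    |x.coord w - y.coord w| ≤ l := by
  induction h with
  | nil => simp
  | @cons x y z u v l a b c _ ih =>
    refine (abs_sub_le _ (y.coord w) _).trans (add_le_add ?_ ih)
    obtain ⟨hx, hx'⟩ := coord_closedEdge a.ne b
    obtain ⟨hy, hy'⟩ := coord_closedEdge a.ne c
    by_cases hu : w = u
    · rw [hu]
    by_cases hv : w = v
    · rw [hv, show x.coord v - y.coord v = -(x.coord u - y.coord u) by linarith, abs_neg]
    · rw [hx' w hu hv, hy' w hu hv]; simp

theorem PathOfLength.exists_to_vertex (x : GraphRealization Γ) :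
    ∃ v l, PathOfLength x (vertex Γ v) l := by
  obtain ⟨u, v, h | h, hx⟩ := x.mem
  · subst h
    refine ⟨u, 0, ?_⟩
    have : x = vertex Γ u := by
      apply GraphRealization.ext
      simpa [closedEdge, segment_same, vertex] using hx
    rw [this]; exact .nil _
  · exact ⟨u, _, .cons h hx (left_mem_segment ℝ _ _) (.nil _)⟩

theorem PathOfLength.exists_of_connected (h : Γ.Connected) (x y : GraphRealization Γ) :
    ∃ l, PathOfLength x y l := by
  obtain ⟨u, l, hu⟩ := exists_to_vertex x
  obtain ⟨v, m, hv⟩ := exists_to_vertex y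
  have key : ∀ {u v : V}, Γ.Walk u v → ∃ l, PathOfLength (vertex Γ u) (vertex Γ v) l := by
    intro u v p
    induction p with
    | nil => exact ⟨0, .nil _⟩
    | cons a _ ih =>
      obtain ⟨l, hl⟩ := ih
      exact ⟨_, .cons a (left_mem_segment ℝ _ _) (right_mem_segment ℝ _ _) hl⟩
  obtain ⟨p⟩ := h.preconnected u v
  obtain ⟨k, hk⟩ := key p
  exact ⟨_, (hu.trans hk).trans hv.symm⟩

theorem bddBelow_lengths (x y : GraphRealization Γ) : BddBelow {l | PathOfLength x y l} :=
  ⟨0, fun _ h => PathOfLength.nonneg h⟩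

/-- The realization of a connected graph, as a metric space with the combinatorial path metric. -/
@[reducible]
def metricSpace (h : Γ.Connected) : MetricSpace (GraphRealization Γ) where
  dist := pathDist
  dist_self x := le_antisymm (csInf_le (bddBelow_lengths x x) (.nil x))
    (Real.sInf_nonneg fun _ h => PathOfLength.nonneg h)
  dist_comm x y := by
    have : {l | PathOfLength x y l} = {l | PathOfLength y x l} :=
      Set.ext fun _ => ⟨PathOfLength.symm, PathOfLength.symm⟩
    change sInf _ = sInf _
    rw [this]
  dist_triangle x y z := by
    change pathDist x z ≤ sInf {l | PathOfLength x y l} + sInf {l | PathOfLength y z l}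
    have h1 := PathOfLength.exists_of_connected h x y
    have h2 := PathOfLength.exists_of_connected h y z
    rw [← sub_le_iff_le_add]
    refine le_csInf h1 fun l hl => ?_
    rw [sub_le_comm]
    refine le_csInf h2 fun m hm => ?_
    rw [sub_le_iff_le_add, add_comm m]
    exact csInf_le (bddBelow_lengths x z) (hl.trans hm)
  eq_of_dist_eq_zero {x y} hxy := by
    apply GraphRealization.ext
    ext w
    have : |x.coord w - y.coord w| ≤ pathDist x y :=
      le_csInf (PathOfLength.exists_of_connected h x y) fun l hl => hl.coord_le w
    rw [show pathDist x y = 0 from hxy] at this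
    exact sub_eq_zero.1 (abs_nonpos_iff.1 this)

/-- The part of the realization of `Γ` covered by a subgraph. -/
def ofSubgraph (A : Γ.Subgraph) : Set (GraphRealization Γ) :=
  {x | ∃ u v, ((u = v ∧ u ∈ A.verts) ∨ A.Adj u v) ∧ x.coord ∈ closedEdge u v}

end GraphRealization

/-! ### Cayley graphs and coends -/

section Cayley

variable {G : Type u} [Group G]

theorem mulCayley_connected (S : Set G) (hS : Subgroup.closure S = ⊤) :
    (SimpleGraph.mulCayley S).Connected := by
  have step : ∀ (g s : G), s ∈ S → (SimpleGraph.mulCayley S).Reachable g (g * s) := by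
    intro g s hs
    by_cases h : g = g * s
    · rw [← h]
    · exact SimpleGraph.Adj.reachable
        ((SimpleGraph.mulCayley_adj' S _ _).2 ⟨h, s, hs, Or.inl rfl⟩)
  have key : ∀ x : G, ∀ g : G, (SimpleGraph.mulCayley S).Reachable g (g * x) := by
    intro x
    have hx : x ∈ Subgroup.closure S := by rw [hS]; trivial
    induction hx using Subgroup.closure_induction with
    | mem s hs => exact fun g => step g s hs
    | one => intro g; rw [mul_one]
    | mul x y _ _ ihx ihy => intro g; rw [← mul_assoc]; exact (ihx g).trans (ihy (g * x))
    | inv x _ ih => intro g; simpa using (ih (g * x⁻¹)).symm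
  have : Nonempty G := ⟨1⟩
  exact ⟨fun u v => by simpa using key (u⁻¹ * v) u⟩

/-- The Cayley graph of `G` with respect to the generating set `S`, as a space. -/
def CayleySpace (S : Set G) (_hS : Subgroup.closure S = ⊤) : Type u :=
  GraphRealization (SimpleGraph.mulCayley S)

variable {S : Set G} {hS : Subgroup.closure S = ⊤}

instance : MetricSpace (CayleySpace S hS) :=
  GraphRealization.metricSpace (mulCayley_connected S hS)

/-- Elements of `G` as vertices of the Cayley graph. -/
def CayleySpace.vertex (S : Set G) (hS : Subgroup.closure S = ⊤) (g : G) : CayleySpace S hS :=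
  GraphRealization.vertex (SimpleGraph.mulCayley S) g

theorem mulCayley_adj_mul_left (S : Set G) (g : G) {u v : G}
    (h : (SimpleGraph.mulCayley S).Adj u v) : (SimpleGraph.mulCayley S).Adj (g * u) (g * v) := by
  rw [SimpleGraph.mulCayley_adj'] at *
  obtain ⟨hne, s, hs, h | h⟩ := h
  · exact ⟨fun e => hne (mul_left_cancel e), s, hs, Or.inl (by rw [mul_assoc, h])⟩
  · exact ⟨fun e => hne (mul_left_cancel e), s, hs, Or.inr (by rw [mul_assoc, h])⟩

theorem mapDomain_mem_closedEdge (g : G) {u v : G} {x : G →₀ ℝ} (hx : x ∈ closedEdge u v) :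
    Finsupp.mapDomain (g * ·) x ∈ closedEdge (g * u) (g * v) := by
  obtain ⟨a, b, ha, hb, hab, rfl⟩ := hx
  refine ⟨a, b, ha, hb, hab, ?_⟩
  simp [Finsupp.mapDomain_add, Finsupp.mapDomain_single]

/-- The action of `G` on its Cayley graph by left translations. -/
instance : MulAction G (CayleySpace S hS) where
  smul g x := ⟨Finsupp.mapDomain (g * ·) x.coord, by
    obtain ⟨u, v, h, hx⟩ := x.mem
    exact ⟨g * u, g * v, h.imp (congrArg _) (mulCayley_adj_mul_left S g),
      mapDomain_mem_closedEdge g hx⟩⟩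
  one_smul x := by
    apply GraphRealization.ext
    change Finsupp.mapDomain _ _ = _
    simp only [one_mul]
    exact Finsupp.mapDomain_id
  mul_smul g h x := by
    apply GraphRealization.ext
    change Finsupp.mapDomain _ _ = Finsupp.mapDomain _ (Finsupp.mapDomain _ _)
    rw [← Finsupp.mapDomain_comp]
    congr 1
    funext k
    exact mul_assoc g h k

/-- The subset of the Cayley graph covered by a subgraph. -/
def CayleySpace.ofSubgraph (S : Set G) (hS : Subgroup.closure S = ⊤)
    (A : (SimpleGraph.mulCayley S).Subgraph) : Set (CayleySpace S hS) :=
  GraphRealization.ofSubgraph A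

/-- The non-empty connected `P`-invariant subgraphs of the Cayley graph with compact quotient
under `P`. -/
def cocompactSubgraphs (S : Set G) (hS : Subgroup.closure S = ⊤) (P : Subgroup G) :
    Set (SimpleGraph.mulCayley S).Subgraph :=
  {A | A.verts.Nonempty ∧ A.Connected ∧
    (∀ p ∈ P, ∀ v ∈ A.verts, p * v ∈ A.verts) ∧
    (∀ p ∈ P, ∀ u v, A.Adj u v → A.Adj (p * u) (p * v)) ∧
    IsCompact ((Quotient.mk (MulAction.orbitRel P (CayleySpace S hS))) ''
      CayleySpace.ofSubgraph S hS A)}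

/-- The connected components of the complement of `A` in the Cayley graph which are not contained
in any cocompact subgraph. -/
def essentialComponents (S : Set G) (hS : Subgroup.closure S = ⊤) (P : Subgroup G)
    (A : (SimpleGraph.mulCayley S).Subgraph) : Set (Set (CayleySpace S hS)) :=
  {K | (∃ x ∈ (CayleySpace.ofSubgraph S hS A)ᶜ,
      K = connectedComponentIn (CayleySpace.ofSubgraph S hS A)ᶜ x) ∧
    ∀ B ∈ cocompactSubgraphs S hS P, ¬ K ⊆ CayleySpace.ofSubgraph S hS B}

/-- Coends of the pair `(G, P)`: the inverse limit of the sets of essential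
components over the cocompact subgraphs ordered by inclusion. The transition function for `A ≤ B`
maps a component `K` of the complement of `B` to the component of the complement of `A` that
contains `K`. -/
def Coends (S : Set G) (hS : Subgroup.closure S = ⊤) (P : Subgroup G) : Type u :=
  {K : cocompactSubgraphs S hS P → Set (CayleySpace S hS) //
    (∀ A, K A ∈ essentialComponents S hS P A.1) ∧
    ∀ A B : cocompactSubgraphs S hS P, A.1 ≤ B.1 → K B ⊆ K A}

end Cayley

end

/-!
Both sides of every claim are handled through relations between representatives, and one criterion
is used throughout: two ends `A`, `B`, possibly at different scales, define the same filtered end as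
soon as, at some common scale, a point of `A_ν` can be joined to a point of `B_ν` outside `C^{+ν}`
for every `ν` (`FilteredEnds.mk_eq_mk_of_joined`).

*Functoriality.* A morphism `f` carries points far from `C` to points far from `D`, because `D` lies
near `f(C)` and `f` is a quasi-isometric map. Hence the images of the components of an end `A` lie
in the components of an end `B` (`QPMet.IsMorphism.exists_mapsTo`), written `A.MapsTo f B`. By the
criterion the class of `B` depends only on the class of `A`, and only on `f` up to bounded distance
(`EndsAtScale.MapsTo.mk_eq_mk_of_dist_le`). The functor laws and the invariance under maps close to
the identity follow at once; a quasi-isometry induces a bijection because its quasi-inverse is a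
morphism that induces the inverse (`QPMet.exists_quasiInverse`).

*Geodesic spaces and Cayley graphs.* In both kinds of space points are joined by paths staying
near their starting point (`HasShortPaths`), so a coarse path outside `C^{+(μ+σ+1)}` can be filled
to a path outside `C^{+μ}` (`EndsAtScale.joinedIn`); conversely a connected set is coarsely
connected at every positive scale, and an end never lives at scale `0` (`EndsAtScale.scale_pos`). This
translates between coarse components and path components. In a proper geodesic space, filling the
jumps between points of `A_0, A_1, …` gives a ray running into `A` and every proper ray runs into an
end at scale `1`.

*Coends.* Let `depth` be the word distance to `P`, extended affinely over the edges of the Cayley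
graph. It is `1`-Lipschitz, `P`-invariant, and differs from the distance to `P` by a bounded amount.
It descends to a continuous function on the quotient by `P`, so cocompact subgraphs lie in
neighbourhoods of `P`; conversely the full subgraphs on the vertices of depth at most `n` are
cocompact as `S` is finite, and connected for large `n` as `P` is finitely generated
(`CayleySpace.exists_cofinal_cocompactSubgraphs`). So complements of cocompact
subgraphs and of neighbourhoods of `P` are cofinal in each other. The components of a coend lie in no
neighbourhood of `P`, so they are unbounded and determine an end; conversely an end has points at
every depth, so the components containing it lie in no cocompact subgraph.
-/

/-! ### Ends at a fixed scale and their classes -/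

section EndsBasics

variable {X : Type u} [MetricSpace X] {C : Set X}

theorem mem_outside {μ : ℝ≥0} {x : X} : x ∈ outside C μ ↔ ∀ c ∈ C, (μ : ℝ) ≤ dist x c := by
  simp only [outside, mem_compl_iff, Metric.mem_thickening_iff, not_exists, not_and, not_lt]

theorem coarseComponent_subset (Z : Set X) (σ : ℝ≥0) (x : X) : coarseComponent Z σ x ⊆ Z :=
  fun _ h => h.1

theorem CoarselyJoined.single {Z : Set X} {σ : ℝ≥0} {x y : X} (hx : x ∈ Z) (hy : y ∈ Z)
    (h : dist x y ≤ σ) : CoarselyJoined Z σ x y :=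
  Relation.ReflTransGen.single ⟨hx, hy, h⟩

namespace EndsAtScale

variable {σ τ : ℝ≥0}

theorem subset_outside (A : EndsAtScale C σ) (μ : ℝ≥0) : A.comp μ ⊆ outside C μ := by
  obtain ⟨⟨x, hx, hA⟩, -⟩ := A.mem μ
  rw [hA]
  exact coarseComponent_subset _ _ _

theorem comp_nonempty (A : EndsAtScale C σ) (μ : ℝ≥0) : (A.comp μ).Nonempty := by
  obtain ⟨⟨x, hx, hA⟩, -⟩ := A.mem μ
  exact ⟨x, by rw [hA]; exact ⟨hx, .refl⟩⟩

theorem not_isBounded (A : EndsAtScale C σ) (μ : ℝ≥0) : ¬ Bornology.IsBounded (A.comp μ) :=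
  (A.mem μ).2

theorem comp_eq (A : EndsAtScale C σ) {μ : ℝ≥0} {x : X} (hx : x ∈ A.comp μ) :
    A.comp μ = coarseComponent (outside C μ) σ x := by
  obtain ⟨⟨y, hy, hA⟩, -⟩ := A.mem μ
  rw [hA] at hx ⊢
  exact coarseComponent_eq hx.2

theorem joined (A : EndsAtScale C σ) {μ : ℝ≥0} {x y : X} (hx : x ∈ A.comp μ)
    (hy : y ∈ A.comp μ) : CoarselyJoined (outside C μ) σ x y := by
  rw [A.comp_eq hx] at hy
  exact hy.2

theorem mem_of_joined (A : EndsAtScale C σ) {μ : ℝ≥0} {x y : X} (hx : x ∈ A.comp μ)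
    (hy : y ∈ outside C μ) (h : CoarselyJoined (outside C μ) σ x y) : y ∈ A.comp μ := by
  rw [A.comp_eq hx]
  exact ⟨hy, h⟩

theorem transition_comp (h : σ ≤ τ) (A : EndsAtScale C σ) {μ : ℝ≥0} {x : X}
    (hx : x ∈ A.comp μ) :
    (transition h A).comp μ = coarseComponent (outside C μ) τ x := by
  change coarseHull _ _ _ = _
  rw [A.comp_eq hx, coarseHull_component h (A.subset_outside μ hx)]

theorem subset_transition (h : σ ≤ τ) (A : EndsAtScale C σ) (μ : ℝ≥0) :
    A.comp μ ⊆ (transition h A).comp μ := by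
  intro x hx
  rw [transition_comp h A hx]
  exact ⟨A.subset_outside μ hx, .refl⟩

/-- At scale `0` the components are points, so an end can only live at a positive scale. -/
theorem scale_pos (A : EndsAtScale C σ) : 0 < σ := by
  by_contra h0
  obtain rfl : σ = 0 := le_antisymm (not_lt.1 h0) bot_le
  obtain ⟨x, hx⟩ := A.comp_nonempty 0
  refine A.not_isBounded 0 (Bornology.isBounded_singleton (x := x) |>.subset fun y hy => ?_)
  have hj := A.joined hx hy
  clear hy
  induction hj with
  | refl => rfl
  | tail _ h ih =>
    have hd := dist_le_zero.1 h.2.2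
    rw [← hd]
    exact ih

/-- A decreasing system of nonempty unbounded sets `T μ`, each `σ`-coarsely connected outside
`C^{+μ}`, lies in an end at scale `σ`. -/
theorem exists_of_system {T : ℝ≥0 → Set X} (hanti : ∀ μ ν, μ ≤ ν → T ν ⊆ T μ)
    (hsub : ∀ μ, T μ ⊆ outside C μ) (hne : ∀ μ, (T μ).Nonempty)
    (hub : ∀ μ, ¬ Bornology.IsBounded (T μ))
    (hj : ∀ μ, ∀ x ∈ T μ, ∀ y ∈ T μ, CoarselyJoined (outside C μ) σ x y) :
    ∃ B : EndsAtScale C σ, ∀ μ, T μ ⊆ B.comp μ := by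
  choose x hx using hne
  have hT : ∀ μ, T μ ⊆ coarseComponent (outside C μ) σ (x μ) := fun μ y hy =>
    ⟨hsub μ hy, hj μ _ (hx μ) _ hy⟩
  refine ⟨⟨fun μ => coarseComponent (outside C μ) σ (x μ),
    fun μ => ⟨⟨x μ, hsub μ (hx μ), rfl⟩, fun hb => hub μ (hb.subset (hT μ))⟩,
    fun μ ν hμν y hy => ⟨outside_anti C hμν hy.1, ?_⟩⟩, hT⟩
  exact (hj μ _ (hx μ) _ (hanti μ ν hμν (hx ν))).trans
    (hy.2.mono (outside_anti C hμν) le_rfl)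

end EndsAtScale

namespace FilteredEnds

variable {σ τ : ℝ≥0}

theorem mk_eq_mk_iff {A : EndsAtScale C σ} {B : EndsAtScale C τ} :
    mk A = mk B ↔ ∃ (κ : ℝ≥0) (ha : σ ≤ κ) (hb : τ ≤ κ),
      EndsAtScale.transition ha A = EndsAtScale.transition hb B :=
  ⟨fun h => Quotient.exact h, fun h => Quotient.sound h⟩

theorem exists_rep (e : FilteredEnds C) : ∃ (σ : ℝ≥0) (A : EndsAtScale C σ), mk A = e := by
  obtain ⟨⟨σ, A⟩, rfl⟩ := Quotient.exists_rep e
  exact ⟨σ, A, rfl⟩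

/-- Two ends, possibly at different scales, define the same filtered end as soon as at some common
scale `κ` they can be joined outside every neighbourhood of `C`. -/
theorem mk_eq_mk_of_joined {A : EndsAtScale C σ} {B : EndsAtScale C τ} (κ : ℝ≥0)
    (h : ∀ ν, ∃ x ∈ A.comp ν, ∃ y ∈ B.comp ν, CoarselyJoined (outside C ν) κ x y) :
    mk A = mk B := by
  refine mk_eq_mk_iff.2 ⟨max κ (max σ τ), by simp, by simp, ?_⟩
  apply EndsAtScale.ext
  funext ν
  obtain ⟨x, hx, y, hy, hxy⟩ := h ν
  rw [EndsAtScale.transition_comp _ A hx, EndsAtScale.transition_comp _ B hy]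
  exact coarseComponent_eq (hxy.mono subset_rfl (le_max_left _ _))

/-- A relation between representatives of filtered ends and the elements of `T` that is total,
surjective, and compatible with equality on both sides is the graph of a bijection. -/
theorem exists_equiv_of_rel {T : Type*} (R : ∀ {σ : ℝ≥0}, EndsAtScale C σ → T → Prop)
    (htotal : ∀ {σ : ℝ≥0} (A : EndsAtScale C σ), ∃ t, R A t)
    (hsurj : ∀ t, ∃ (σ : ℝ≥0) (A : EndsAtScale C σ), R A t)
    (hiff : ∀ {σ τ : ℝ≥0} (A : EndsAtScale C σ) (B : EndsAtScale C τ) (s t : T),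
      R A s → R B t → (mk A = mk B ↔ s = t)) :
    ∃ Φ : FilteredEnds C ≃ T, ∀ {σ : ℝ≥0} (A : EndsAtScale C σ), R A (Φ (mk A)) := by
  have hrep : ∀ e : FilteredEnds C, ∃ t, ∀ (σ : ℝ≥0) (A : EndsAtScale C σ), mk A = e → R A t := by
    intro e
    obtain ⟨τ, B, rfl⟩ := exists_rep e
    obtain ⟨t, ht⟩ := htotal B
    refine ⟨t, fun σ A h => ?_⟩
    obtain ⟨s, hs⟩ := htotal A
    exact (hiff A B s t hs ht).1 h ▸ hs
  choose F hF using hrep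
  refine ⟨Equiv.ofBijective F ⟨fun e e' h => ?_, fun t => ?_⟩, fun A => hF _ _ A rfl⟩
  · obtain ⟨σ, A, rfl⟩ := exists_rep e
    obtain ⟨τ, B, rfl⟩ := exists_rep e'
    exact (hiff A B _ _ (hF _ _ A rfl) (hF _ _ B rfl)).2 h
  · obtain ⟨σ, A, hA⟩ := hsurj t
    exact ⟨mk A, (hiff A A _ _ (hF _ _ A rfl) hA).1 rfl⟩

end FilteredEnds

end EndsBasics

/-! ### The map induced on ends -/

section InducedMap

variable {X Y Z : Type u} [MetricSpace X] [MetricSpace Y] [MetricSpace Z]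
  {C : Set X} {D : Set Y} {E : Set Z} {σ τ κ : ℝ≥0}

/-- `f` carries the end `A` into the end `B`: every component of `B` contains the image of some
component of `A`. -/
def EndsAtScale.MapsTo (f : X → Y) (A : EndsAtScale C σ) (B : EndsAtScale D τ) : Prop :=
  ∀ ν : ℝ≥0, ∃ μ : ℝ≥0, f '' A.comp μ ⊆ B.comp ν

namespace EndsAtScale.MapsTo

theorem refl (A : EndsAtScale C σ) : MapsTo (fun x => x) A A :=
  fun ν => ⟨ν, by simp⟩

theorem comp {f : X → Y} {g : Y → Z} {A : EndsAtScale C σ} {B : EndsAtScale D τ}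
    {F : EndsAtScale E κ} (hg : MapsTo g B F) (hf : MapsTo f A B) :
    MapsTo (fun x => g (f x)) A F := by
  intro ν
  obtain ⟨μ, hμ⟩ := hg ν
  obtain ⟨l, hl⟩ := hf μ
  refine ⟨l, ?_⟩
  rintro _ ⟨x, hx, rfl⟩
  exact hμ ⟨f x, hl ⟨x, hx, rfl⟩, rfl⟩

theorem of_transition {f : X → Y} {A : EndsAtScale C σ} {B : EndsAtScale D τ} (h : σ ≤ κ)
    (hf : MapsTo f (transition h A) B) : MapsTo f A B := by
  intro ν
  obtain ⟨μ, hμ⟩ := hf ν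
  exact ⟨μ, (image_mono (subset_transition h A μ)).trans hμ⟩

/-- The points of arbitrarily deep components of `A` are carried into the components of `B`. -/
theorem exists_mem {f : X → Y} {A : EndsAtScale C σ} {B : EndsAtScale D τ} (hf : MapsTo f A B)
    (ν : ℝ≥0) : ∃ l, ∀ μ, l ≤ μ → ∀ x ∈ A.comp μ, f x ∈ B.comp ν := by
  obtain ⟨l, hl⟩ := hf ν
  exact ⟨l, fun μ hμ x hx => hl ⟨x, A.anti _ _ hμ hx, rfl⟩⟩

/-- Maps at bounded distance from each other carry an end into the same end. -/
theorem mk_eq_mk_of_dist_le {f g : X → Y} {A : EndsAtScale C σ} {B : EndsAtScale D τ}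
    {B' : EndsAtScale D κ} (hf : MapsTo f A B) (hg : MapsTo g A B') {r : ℝ}
    (h : ∀ x, dist (f x) (g x) ≤ r) : FilteredEnds.mk B = FilteredEnds.mk B' := by
  refine FilteredEnds.mk_eq_mk_of_joined r.toNNReal fun ν => ?_
  obtain ⟨l, hl⟩ := hf.exists_mem ν
  obtain ⟨m, hm⟩ := hg.exists_mem ν
  obtain ⟨x, hx⟩ := A.comp_nonempty (max l m)
  have h1 := hl _ (le_max_left _ _) x hx
  have h2 := hm _ (le_max_right _ _) x hx
  exact ⟨_, h1, _, h2, .single (B.subset_outside _ h1) (B'.subset_outside _ h2)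
    ((h x).trans (Real.le_coe_toNNReal r))⟩

theorem mk_eq_mk {f : X → Y} {A : EndsAtScale C σ} {B : EndsAtScale D τ}
    {B' : EndsAtScale D κ} (hf : MapsTo f A B) (hg : MapsTo f A B') :
    FilteredEnds.mk B = FilteredEnds.mk B' :=
  hf.mk_eq_mk_of_dist_le hg (r := 0) fun x => by simp

end EndsAtScale.MapsTo

theorem CoarselyJoined.image {f : X → Y} {Z : Set X} {W : Set Y} {K : ℝ≥0}
    (hf : ∀ x y, dist (f x) (f y) ≤ K * dist x y + K) (hZ : ∀ x ∈ Z, f x ∈ W) {x y : X}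
    (h : CoarselyJoined Z σ x y) : CoarselyJoined W (K * σ + K) (f x) (f y) := by
  refine Relation.ReflTransGen.lift f (fun a b ⟨ha, hb, hab⟩ => ⟨hZ a ha, hZ b hb, ?_⟩) _ _ h
  have := mul_le_mul_of_nonneg_left hab K.2
  push_cast
  exact (hf a b).trans (by simpa using this)

/-- A morphism of pairs carries every end of the source into an end of the target. -/
theorem QPMet.IsMorphism.exists_mapsTo {P Q : QPMet.{u}} {f : P.carrier → Q.carrier}
    (hf : QPMet.IsMorphism P Q f) (A : EndsAtScale P.sub σ) :
    ∃ (τ : ℝ≥0) (B : EndsAtScale Q.sub τ), A.MapsTo f B := by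
  obtain ⟨hq, r, hr, hD⟩ := hf
  obtain ⟨K, hK, h⟩ := (isQuasiIsometricMap_iff f).1 hq
  lift K to ℝ≥0 using hK
  lift r to ℝ≥0 using hr
  -- the image of a point at distance `≥ K (ν + r) + K + 1` from `C` is at distance `≥ ν` from `D`
  have hout : ∀ ν : ℝ≥0, ∀ x ∈ outside P.sub (K * (ν + r) + K + 1), f x ∈ outside Q.sub ν := by
    intro ν x hx
    rw [mem_outside] at hx ⊢
    intro d hd
    obtain ⟨_, ⟨c, hc, rfl⟩, hdc⟩ := Metric.mem_thickening_iff.1 (hD hd)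
    by_contra! hlt
    have h1 := hx c hc
    have h2 := (h x c).2
    have h3 := dist_triangle (f x) d (f c)
    have h4 : dist (f x) (f c) < ν + r := by linarith
    push_cast at h1
    have h5 := mul_le_mul_of_nonneg_left h4.le K.coe_nonneg
    linarith
  have hmono : ∀ μ ν : ℝ≥0, μ ≤ ν → K * (μ + r) + K + 1 ≤ K * (ν + r) + K + 1 :=
    fun μ ν hμν => by gcongr
  obtain ⟨B, hB⟩ := EndsAtScale.exists_of_system (C := Q.sub) (σ := K * σ + K)
    (T := fun ν => f '' A.comp (K * (ν + r) + K + 1))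
    (fun μ ν hμν => image_mono (A.anti _ _ (hmono μ ν hμν)))
    (fun ν => by
      rintro _ ⟨x, hx, rfl⟩
      exact hout ν x (A.subset_outside _ hx))
    (fun ν => (A.comp_nonempty _).image f)
    (fun ν hb => by
      refine A.not_isBounded (K * (ν + r) + K + 1) ?_
      obtain ⟨R, hR⟩ := Metric.isBounded_iff.1 hb
      refine Metric.isBounded_iff.2 ⟨K * R + K, fun x hx y hy => (h x y).2.trans ?_⟩
      have := hR ⟨x, hx, rfl⟩ ⟨y, hy, rfl⟩
      gcongr)
    (fun ν => by
      rintro _ ⟨x, hx, rfl⟩ _ ⟨y, hy, rfl⟩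
      exact (A.joined hx hy).image (fun x y => (h x y).1) (hout ν))
  exact ⟨_, B, fun ν => ⟨_, hB ν⟩⟩

/-- The class of the end into which a representative of `e` is carried depends only on `e`. -/
theorem QPMet.IsMorphism.exists_map {P Q : QPMet.{u}} {f : P.carrier → Q.carrier}
    (hf : QPMet.IsMorphism P Q f) (e : P.Ends) :
    ∃ e' : Q.Ends, ∀ (σ τ : ℝ≥0) (A : EndsAtScale P.sub σ) (B : EndsAtScale Q.sub τ),
      FilteredEnds.mk A = e → A.MapsTo f B → FilteredEnds.mk B = e' := by
  obtain ⟨σ, A, rfl⟩ := FilteredEnds.exists_rep e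
  obtain ⟨τ, B, hB⟩ := hf.exists_mapsTo A
  refine ⟨FilteredEnds.mk B, fun σ' τ' A' B' hA hB' => ?_⟩
  obtain ⟨κ, h, h', heq⟩ := FilteredEnds.mk_eq_mk_iff.1 hA
  obtain ⟨τ'', B'', hB''⟩ := hf.exists_mapsTo (EndsAtScale.transition h A')
  exact (hB'.mk_eq_mk hB''.of_transition).trans
    (EndsAtScale.MapsTo.mk_eq_mk (heq ▸ hB'').of_transition hB)

/-- The function on filtered ends induced by a morphism of pairs. -/
noncomputable def QPMet.Hom.endsFun {P Q : QPMet.{u}} (f : QPMet.Hom P Q) (e : P.Ends) : Q.Ends :=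
  (f.isMorphism.exists_map e).choose

theorem QPMet.Hom.endsFun_mk {P Q : QPMet.{u}} (f : QPMet.Hom P Q) {A : EndsAtScale P.sub σ}
    {B : EndsAtScale Q.sub τ} (h : A.MapsTo f.toFun B) :
    f.endsFun (FilteredEnds.mk A) = FilteredEnds.mk B :=
  ((f.isMorphism.exists_map _).choose_spec σ τ A B rfl h).symm

/-- Morphisms at bounded distance from each other induce the same function on ends. -/
theorem QPMet.Hom.endsFun_eq_of_dist_le {P Q : QPMet.{u}} (f g : QPMet.Hom P Q) {r : ℝ}
    (h : ∀ x, dist (f.toFun x) (g.toFun x) ≤ r) (e : P.Ends) : f.endsFun e = g.endsFun e := by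
  obtain ⟨σ, A, rfl⟩ := FilteredEnds.exists_rep e
  obtain ⟨τ, B, hB⟩ := f.isMorphism.exists_mapsTo A
  obtain ⟨κ, B', hB'⟩ := g.isMorphism.exists_mapsTo A
  rw [f.endsFun_mk hB, g.endsFun_mk hB']
  exact hB.mk_eq_mk_of_dist_le hB' h

theorem QPMet.Hom.endsFun_id {P : QPMet.{u}} (e : P.Ends) :
    QPMet.Hom.endsFun (CategoryTheory.CategoryStruct.id P) e = e := by
  obtain ⟨σ, A, rfl⟩ := FilteredEnds.exists_rep e
  exact QPMet.Hom.endsFun_mk _ (.refl A)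

theorem QPMet.Hom.endsFun_comp {P Q R : QPMet.{u}} (f : QPMet.Hom P Q) (g : QPMet.Hom Q R)
    (e : P.Ends) :
    QPMet.Hom.endsFun (CategoryTheory.CategoryStruct.comp (obj := QPMet.{u}) f g) e =
      g.endsFun (f.endsFun e) := by
  obtain ⟨σ, A, rfl⟩ := FilteredEnds.exists_rep e
  obtain ⟨τ, B, hB⟩ := f.isMorphism.exists_mapsTo A
  obtain ⟨κ, F, hF⟩ := g.isMorphism.exists_mapsTo B
  rw [f.endsFun_mk hB, g.endsFun_mk hF]
  exact QPMet.Hom.endsFun_mk _ (hF.comp hB)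

/-- The functor of filtered ends. -/
noncomputable def QPMet.endsFunctor : CategoryTheory.Functor QPMet.{u} (Type u) where
  obj P := P.Ends
  map f := TypeCat.ofHom (QPMet.Hom.endsFun f)
  map_id P := by
    ext e
    exact QPMet.Hom.endsFun_id e
  map_comp f g := by
    ext e
    exact QPMet.Hom.endsFun_comp f g e

/-! ### Quasi-isometries of pairs -/

theorem IsCoarseLipschitz.exists_le {L A : ℝ} {q : X → Y} (h : IsCoarseLipschitz L A q) :
    ∃ K : ℝ, 0 ≤ K ∧ ∀ x y, dist (q x) (q y) ≤ K * dist x y + K := by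
  refine ⟨max 0 (max L A), le_max_left _ _, fun x y => (h x y).trans ?_⟩
  have h1 : L ≤ max 0 (max L A) := (le_max_left _ _).trans (le_max_right _ _)
  have h2 : A ≤ max 0 (max L A) := (le_max_right _ _).trans (le_max_right _ _)
  gcongr

theorem IsCoarseLipschitz.isQuasiIsometricMap {L A L' A' r : ℝ} {q : X → Y} {q' : Y → X}
    (h : IsCoarseLipschitz L A q) (h' : IsCoarseLipschitz L' A' q')
    (hr : ∀ x, dist (q' (q x)) x ≤ r) : IsQuasiIsometricMap q := by
  obtain ⟨K, hK, h⟩ := h.exists_le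
  obtain ⟨M, hM, h'⟩ := h'.exists_le
  refine (isQuasiIsometricMap_iff q).2 ⟨K + M + 2 * |r|, by positivity, fun x y => ⟨?_, ?_⟩⟩
  · refine (h x y).trans ?_
    have h1 : K ≤ K + M + 2 * |r| := by linarith [abs_nonneg r]
    gcongr
  · have h1 := dist_triangle4 x (q' (q x)) (q' (q y)) y
    have h2 := h' (q x) (q y)
    have h3 := hr x
    have h4 := hr y
    rw [dist_comm] at h3
    have h5 := mul_nonneg (add_nonneg hK (mul_nonneg zero_le_two (abs_nonneg r)))
      (dist_nonneg (x := q x) (y := q y))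
    linarith [le_abs_self r]

/-- A quasi-isometry `f` for which `f(C)` and `D` are at finite Hausdorff distance is a morphism of
pairs, and so is a quasi-inverse of it. -/
theorem QPMet.exists_quasiInverse {P Q : QPMet.{u}} {f : P.carrier → Q.carrier}
    (hf : IsQuasiIsometry f) (hH : Metric.hausdorffEDist (f '' P.sub) Q.sub ≠ ⊤) :
    QPMet.IsMorphism P Q f ∧ ∃ (g : Q.carrier → P.carrier) (r : ℝ), QPMet.IsMorphism Q P g ∧
      (∀ x, dist (g (f x)) x ≤ r) ∧ (∀ y, dist (f (g y)) y ≤ r) := by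
  obtain ⟨L, r, h, g, ⟨A, h'⟩, hgf, hfg⟩ := hf
  set δ := Metric.hausdorffDist (f '' P.sub) Q.sub + 1 with hδ
  have hδ' : Metric.hausdorffDist (f '' P.sub) Q.sub < δ := by linarith
  have hδ0 : 0 ≤ δ := by linarith [Metric.hausdorffDist_nonneg (s := f '' P.sub) (t := Q.sub)]
  refine ⟨⟨h.isQuasiIsometricMap h' hgf, δ, hδ0, fun y hy => ?_⟩, g, r,
    ⟨h'.isQuasiIsometricMap h hfg, ?_⟩, hgf, hfg⟩
  · obtain ⟨z, hz, hyz⟩ := Metric.exists_dist_lt_of_hausdorffDist_lt' hy hδ' hH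
    exact Metric.mem_thickening_iff.2 ⟨z, hz, by rwa [dist_comm]⟩
  · obtain ⟨M, hM, h'⟩ := h'.exists_le
    refine ⟨|r| + (M * δ + M) + 1, by positivity, fun x hx => ?_⟩
    obtain ⟨y, hy, hxy⟩ := Metric.exists_dist_lt_of_hausdorffDist_lt (mem_image_of_mem f hx) hδ' hH
    refine Metric.mem_thickening_iff.2 ⟨g y, ⟨y, hy, rfl⟩, ?_⟩
    have h1 := dist_triangle x (g (f x)) (g y)
    have h2 := hgf x
    rw [dist_comm] at h2
    have h3 := h' (f x) y
    have h4 := mul_le_mul_of_nonneg_left hxy.le hM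
    linarith [le_abs_self r]

theorem QPMet.Hom.bijective_endsFun {P Q : QPMet.{u}} (f : QPMet.Hom P Q) (g : QPMet.Hom Q P)
    {r : ℝ} (hgf : ∀ x, dist (g.toFun (f.toFun x)) x ≤ r)
    (hfg : ∀ y, dist (f.toFun (g.toFun y)) y ≤ r) : Function.Bijective f.endsFun := by
  refine Function.bijective_iff_has_inverse.2 ⟨g.endsFun, fun e => ?_, fun e => ?_⟩
  · rw [← QPMet.Hom.endsFun_comp]
    exact (QPMet.Hom.endsFun_eq_of_dist_le _ (CategoryTheory.CategoryStruct.id P) hgf e).trans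
      (QPMet.Hom.endsFun_id e)
  · rw [← QPMet.Hom.endsFun_comp]
    exact (QPMet.Hom.endsFun_eq_of_dist_le _ (CategoryTheory.CategoryStruct.id Q) hfg e).trans
      (QPMet.Hom.endsFun_id e)

end InducedMap

/-! ### Coarse connectedness and paths -/

section Paths

variable {X : Type u} [MetricSpace X] {C : Set X} {σ τ : ℝ≥0}

/-- Connected sets are coarsely connected at every positive scale. -/
theorem IsPreconnected.coarselyJoined {s Z : Set X} (hs : IsPreconnected s) (hsZ : s ⊆ Z)
    (hσ : 0 < σ) {x y : X} (hx : x ∈ s) (hy : y ∈ s) : CoarselyJoined Z σ x y := by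
  refine hs.induction₂ (CoarselyJoined Z σ) (fun x hx => ?_) (fun _ _ _ _ _ _ h h' => h.trans h')
    (fun _ _ _ _ h => h.symm) hx hy
  filter_upwards [self_mem_nhdsWithin,
    mem_nhdsWithin_of_mem_nhds (Metric.closedBall_mem_nhds x (NNReal.coe_pos.2 hσ))] with y hy hxy
  exact .single (hsZ hx) (hsZ hy) (by rwa [dist_comm])

/-- A connected subset of the complement of `C^{+μ}` that meets the component of an end is
contained in it. -/
theorem EndsAtScale.subset_of_isPreconnected (A : EndsAtScale C σ) {μ : ℝ≥0} {s : Set X}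
    (hs : IsPreconnected s) (hsμ : s ⊆ outside C μ) {x : X} (hx : x ∈ s) (hxA : x ∈ A.comp μ) :
    s ⊆ A.comp μ :=
  fun _ hy => A.mem_of_joined hxA (hsμ hy) (hs.coarselyJoined hsμ A.scale_pos hx hy)

/-- Any two points are joined by a path that stays near its starting point. This holds in geodesic
spaces and, more generally, in length spaces. -/
def HasShortPaths (X : Type u) [MetricSpace X] : Prop :=
  ∀ x y : X, JoinedIn (Metric.closedBall x (dist x y + 1)) x y

theorem outside_of_dist_le {μ r : ℝ≥0} {x y : X} (hx : x ∈ outside C (μ + r))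
    (h : dist x y ≤ r) : y ∈ outside C μ := by
  rw [mem_outside] at hx ⊢
  intro c hc
  have h1 := hx c hc
  have h2 := dist_triangle x y c
  push_cast at h1
  linarith

/-- Filling the jumps of a coarse path by short paths costs a bounded amount of room. -/
theorem CoarselyJoined.joinedIn (hX : HasShortPaths X) {μ : ℝ≥0} {x y : X}
    (hx : x ∈ outside C (μ + (σ + 1))) (h : CoarselyJoined (outside C (μ + (σ + 1))) σ x y) :
    JoinedIn (outside C μ) x y := by
  induction h with
  | refl => exact .refl (outside_anti C le_self_add hx)
  | @tail a b _ h ih =>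
    refine ih.trans ((hX a b).mono fun z hz => outside_of_dist_le h.1 ?_)
    rw [Metric.mem_closedBall, dist_comm] at hz
    push_cast
    linarith [h.2.2]

theorem EndsAtScale.joinedIn (hX : HasShortPaths X) (A : EndsAtScale C σ) {μ : ℝ≥0} {x y : X}
    (hx : x ∈ A.comp (μ + (σ + 1))) (hy : y ∈ A.comp (μ + (σ + 1))) :
    JoinedIn (outside C μ) x y :=
  (A.joined hx hy).joinedIn hX (A.subset_outside _ hx)

end Paths

/-! ### Ends of proper geodesic spaces -/

section Rays

variable {X : Type u}

/-- Countably many paths, the end of each being the beginning of the next, form a ray. -/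
theorem exists_continuous_of_joinedIn [TopologicalSpace X] (S : ℕ → Set X) (x : ℕ → X)
    (h : ∀ n, JoinedIn (S n) (x n) (x (n + 1))) :
    ∃ ρ : ℝ≥0 → X, Continuous ρ ∧ ∀ t, ρ t ∈ S ⌊t⌋₊ := by
  choose γ hγ using h
  let F : ℕ → ℝ≥0 → X := fun n t => (γ n).extend ((t : ℝ) - n)
  have hF : ∀ n, Continuous (F n) := fun n => by
    have := (γ n).continuous_extend
    fun_prop
  have hend : ∀ n : ℕ, F n ((n : ℝ≥0) + 1) = x (n + 1) := fun n => by simp [F]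
  have hbeg : ∀ n : ℕ, F n (n : ℝ≥0) = x n := fun n => by simp [F]
  have heq : ∀ n : ℕ, ∀ t ∈ Icc (n : ℝ≥0) (n + 1), F ⌊t⌋₊ t = F n t := by
    rintro n t ⟨h1, h2⟩
    rcases h2.eq_or_lt with rfl | h2
    · have : ⌊(n : ℝ≥0) + 1⌋₊ = n + 1 := by exact_mod_cast Nat.floor_natCast (R := ℝ≥0) (n + 1)
      rw [this, hend, ← hbeg (n + 1)]
      push_cast
      rfl
    · rw [(Nat.floor_eq_iff (zero_le (a := t))).2 ⟨h1, h2⟩]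
  refine ⟨fun t => F ⌊t⌋₊ t, ?_, fun t => ?_⟩
  · have hlf : LocallyFinite fun n : ℕ => Icc (n : ℝ≥0) (n + 1) := by
      intro t
      refine ⟨Iio (t + 1), Iio_mem_nhds (by simp), (finite_Iic ⌈t + 1⌉₊).subset ?_⟩
      rintro n ⟨s, hs, hst⟩
      have h1 : (n : ℝ≥0) ≤ ⌈t + 1⌉₊ := (hs.1.trans hst.le).trans (Nat.le_ceil _)
      exact_mod_cast h1
    refine hlf.continuous ?_ (fun n => isClosed_Icc) fun n => (hF n).continuousOn.congr (heq n)
    exact eq_univ_of_forall fun t =>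
      mem_iUnion.2 ⟨⌊t⌋₊, Nat.floor_le zero_le, (Nat.lt_floor_add_one t).le⟩
  · exact hγ ⌊t⌋₊ (projIcc 0 1 zero_le_one ((t : ℝ) - ⌊t⌋₊))

variable [MetricSpace X] {C : Set X} {σ τ : ℝ≥0}

theorem IsGeodesicSpace.hasShortPaths (hX : IsGeodesicSpace X) : HasShortPaths X := by
  intro x y
  obtain ⟨γ, h0, h1, hγ⟩ := hX x y
  have hcont : ContinuousOn γ (Icc 0 (dist x y)) := by
    refine LipschitzOnWith.continuousOn (K := 1) (LipschitzOnWith.of_dist_le_mul ?_)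
    intro s hs t ht
    rw [hγ s hs t ht, NNReal.coe_one, one_mul, Real.dist_eq]
  have hl : (0 : ℝ) ∈ Icc 0 (dist x y) := left_mem_Icc.2 dist_nonneg
  have hr : dist x y ∈ Icc 0 (dist x y) := right_mem_Icc.2 dist_nonneg
  have hpc : IsPathConnected (γ '' Icc 0 (dist x y)) :=
    ((convex_Icc _ _).isPathConnected ⟨0, hl⟩).image' hcont
  refine (hpc.joinedIn x ⟨0, hl, h0⟩ y ⟨_, hr, h1⟩).mono ?_
  rintro _ ⟨t, ht, rfl⟩
  rw [Metric.mem_closedBall, ← h0, hγ t ht 0 hl, sub_zero, abs_of_nonneg ht.1, h0]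
  linarith [ht.2]

/-- The ray `ρ` runs into the end `A`: it eventually stays in every component of `A`. -/
def EndsAtScale.Receives (A : EndsAtScale C σ) (ρ : ProperRay X) : Prop :=
  ∀ μ : ℝ≥0, ∀ᶠ t in Filter.atTop, ρ.toFun t ∈ A.comp μ

theorem isCompact_cthickening_compl_subset [ProperSpace X] (hC : IsCompact C) (μ : ℝ≥0) :
    IsCompact (Metric.cthickening μ C) ∧ (Metric.cthickening μ C)ᶜ ⊆ outside C μ :=
  ⟨hC.cthickening, compl_subset_compl.2 (Metric.thickening_subset_cthickening _ _)⟩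

theorem exists_outside_subset_compl (hC : C.Nonempty) {K : Set X} (hK : Bornology.IsBounded K) :
    ∃ m : ℝ≥0, outside C m ⊆ Kᶜ := by
  obtain ⟨c, hc⟩ := hC
  obtain ⟨r, hr⟩ := hK.subset_closedBall c
  refine ⟨(r + 1).toNNReal, fun x hx hxK => ?_⟩
  have h1 := mem_outside.1 hx c hc
  have h2 := hr hxK
  rw [Metric.mem_closedBall] at h2
  have h3 := Real.le_coe_toNNReal (r + 1)
  linarith

/-- The complement of a compact set contains a tail of every proper ray. -/
theorem ProperRay.eventually_notMem {X : Type u} [TopologicalSpace X] (ρ : ProperRay X)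
    {K : Set X} (hK : IsCompact K) : ∀ᶠ t in Filter.atTop, ρ.toFun t ∉ K := by
  obtain ⟨B, hB⟩ := (ρ.proper K hK).bddAbove
  filter_upwards [Filter.eventually_gt_atTop B] with t ht hmem
  exact absurd (hB hmem) (not_le.2 ht)

theorem ProperRay.isPreconnected_image {X : Type u} [TopologicalSpace X] (ρ : ProperRay X)
    (N : ℝ≥0) : IsPreconnected (ρ.toFun '' Ici N) :=
  isPreconnected_Ici.image _ ρ.continuous.continuousOn

theorem ProperRay.not_isBounded_image [ProperSpace X] (ρ : ProperRay X) (N : ℝ≥0) :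
    ¬ Bornology.IsBounded (ρ.toFun '' Ici N) := by
  intro hb
  have hev := ρ.eventually_notMem hb.isCompact_closure
  obtain ⟨t, ht, htN⟩ := (hev.and (Filter.eventually_ge_atTop N)).exists
  exact ht (subset_closure ⟨t, htN, rfl⟩)

/-- Every end of a space with short paths receives a proper ray: join points of the components
`A_n` successively, each by a path in the component of smaller index. -/
theorem EndsAtScale.exists_receives (hX : HasShortPaths X) (hC : C.Nonempty)
    (A : EndsAtScale C σ) : ∃ ρ : ProperRay X, A.Receives ρ := by
  choose x hx using fun n : ℕ => A.comp_nonempty (n + (σ + 1))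
  have hj : ∀ n : ℕ, JoinedIn (A.comp n) (x n) (x (n + 1)) := by
    intro n
    have h1 : JoinedIn (outside C n) (x n) (x (n + 1)) := by
      refine A.joinedIn hX (hx n) (A.anti _ _ ?_ (hx (n + 1)))
      gcongr
      simp
    obtain ⟨γ, hγ⟩ := h1
    refine ⟨γ, fun t => ?_⟩
    refine A.subset_of_isPreconnected (isPreconnected_range γ.continuous) (x := x n) ?_
      ⟨0, γ.source⟩ (A.anti _ _ le_self_add (hx n)) ⟨t, rfl⟩
    rintro _ ⟨t, rfl⟩
    exact hγ t
  obtain ⟨ρ, hρ, hmem⟩ := exists_continuous_of_joinedIn _ x hj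
  have hev : ∀ μ : ℝ≥0, ∀ t, μ + 1 ≤ t → ρ t ∈ A.comp μ := fun μ t ht => by
    refine A.anti _ _ ?_ (hmem t)
    have h1 := Nat.lt_floor_add_one t
    exact (add_le_add_iff_right 1).1 (ht.trans h1.le)
  refine ⟨⟨ρ, hρ, fun K hK => ?_⟩, fun μ => (Filter.eventually_ge_atTop (μ + 1)).mono (hev μ)⟩
  obtain ⟨m, hm⟩ := exists_outside_subset_compl hC hK.isBounded
  refine isCompact_Icc.of_isClosed_subset (hK.isClosed.preimage hρ) (s := Icc 0 (m + 1)) ?_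
  refine fun t ht => ⟨zero_le, ?_⟩
  by_contra! hlt
  exact hm (A.subset_outside _ (hev m t hlt.le)) ht

/-- Every proper ray runs into an end, which consists of the coarse components of its tails. -/
theorem ProperRay.exists_received [ProperSpace X] (hC : IsCompact C) (ρ : ProperRay X) :
    ∃ A : EndsAtScale C 1, A.Receives ρ := by
  have hN : ∀ μ : ℝ≥0, ∃ N : ℝ≥0, ρ.toFun '' Ici N ⊆ outside C μ := by
    intro μ
    obtain ⟨hK, hKμ⟩ := isCompact_cthickening_compl_subset hC μ
    obtain ⟨N, hN⟩ := Filter.eventually_atTop.1 (ρ.eventually_notMem hK)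
    refine ⟨N, ?_⟩
    rintro _ ⟨t, ht, rfl⟩
    exact hKμ (hN t ht)
  choose N hN using hN
  have hx : ∀ μ, ρ.toFun (N μ) ∈ ρ.toFun '' Ici (N μ) := fun μ => ⟨_, self_mem_Ici, rfl⟩
  have hsub : ∀ μ, ρ.toFun '' Ici (N μ) ⊆ coarseComponent (outside C μ) 1 (ρ.toFun (N μ)) :=
    fun μ y hy => ⟨hN μ hy, (ρ.isPreconnected_image _).coarselyJoined (hN μ) one_pos (hx μ) hy⟩
  refine ⟨⟨fun μ => coarseComponent (outside C μ) 1 (ρ.toFun (N μ)),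
    fun μ => ⟨⟨_, hN μ (hx μ), rfl⟩,
      fun hb => ρ.not_isBounded_image _ (hb.subset (hsub μ))⟩, fun μ ν hμν y hy => ?_⟩, fun μ => ?_⟩
  · have hmax : ρ.toFun (max (N μ) (N ν)) ∈ coarseComponent (outside C ν) 1 (ρ.toFun (N ν)) :=
      hsub ν ⟨_, mem_Ici.2 (le_max_right _ _), rfl⟩
    have hmax' : ρ.toFun (max (N μ) (N ν)) ∈ coarseComponent (outside C μ) 1 (ρ.toFun (N μ)) :=
      hsub μ ⟨_, mem_Ici.2 (le_max_left _ _), rfl⟩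
    exact ⟨outside_anti C hμν hy.1, hmax'.2.trans
      (CoarselyJoined.mono (outside_anti C hμν) le_rfl (hmax.2.symm.trans hy.2))⟩
  · exact (Filter.eventually_ge_atTop (N μ)).mono fun t ht => hsub μ ⟨t, ht, rfl⟩

theorem EndsAtScale.Receives.transition {A : EndsAtScale C σ} {ρ : ProperRay X}
    (h : A.Receives ρ) (hστ : σ ≤ τ) : (EndsAtScale.transition hστ A).Receives ρ :=
  fun μ => (h μ).mono fun _ ht => A.subset_transition hστ μ ht

theorem ProperRay.sameEnd_of_receives (hX : HasShortPaths X) (hC : C.Nonempty)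
    {A : EndsAtScale C σ} {ρ ρ' : ProperRay X} (h : A.Receives ρ) (h' : A.Receives ρ') :
    ρ.SameEnd ρ' := by
  intro K hK
  obtain ⟨m, hm⟩ := exists_outside_subset_compl hC hK.isBounded
  obtain ⟨N, hN⟩ := Filter.eventually_atTop.1 ((h (m + (σ + 1))).and (h' (m + (σ + 1))))
  obtain ⟨n, hn⟩ := exists_nat_ge N
  exact ⟨n, fun a b ha hb =>
    (A.joinedIn hX (hN a (hn.trans ha)).1 (hN b (hn.trans hb)).2).mono hm⟩

theorem ProperRay.SameEnd.joinedIn_outside [ProperSpace X] (hC : IsCompact C)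
    {ρ ρ' : ProperRay X} (h : ρ.SameEnd ρ') (μ : ℝ≥0) :
    ∃ N : ℝ≥0, ∀ a b, N ≤ a → N ≤ b → JoinedIn (outside C μ) (ρ.toFun a) (ρ'.toFun b) := by
  obtain ⟨hK, hKμ⟩ := isCompact_cthickening_compl_subset hC μ
  obtain ⟨N, hN⟩ := h _ hK
  exact ⟨N, fun a b ha hb => (hN a b ha hb).mono hKμ⟩

theorem EndsAtScale.Receives.of_sameEnd [ProperSpace X] (hC : IsCompact C) {A : EndsAtScale C σ}
    {ρ ρ' : ProperRay X} (hA : A.Receives ρ) (h : ρ.SameEnd ρ') : A.Receives ρ' := by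
  intro μ
  obtain ⟨N, hN⟩ := h.joinedIn_outside hC μ
  obtain ⟨a, ha, haN⟩ := ((hA μ).and (Filter.eventually_ge_atTop N)).exists
  filter_upwards [Filter.eventually_ge_atTop N] with b hb
  obtain ⟨γ, hγ⟩ := hN a b haN hb
  refine A.subset_of_isPreconnected (isPreconnected_range γ.continuous) ?_
    ⟨0, γ.source⟩ ha ⟨1, γ.target⟩
  rintro _ ⟨t, rfl⟩
  exact hγ t

theorem EndsAtScale.Receives.mk_eq_mk [ProperSpace X] {A : EndsAtScale C σ}
    {B : EndsAtScale C τ} {ρ : ProperRay X} (hA : A.Receives ρ) (hB : B.Receives ρ) :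
    FilteredEnds.mk A = FilteredEnds.mk B := by
  refine FilteredEnds.mk_eq_mk_of_joined 0 fun ν => ?_
  obtain ⟨t, hA, hB⟩ := ((hA ν).and (hB ν)).exists
  exact ⟨_, hA, _, hB, .refl⟩

/-- The filtered ends of a proper geodesic space relative to a compact set are its usual ends. -/
theorem exists_equiv_rayEnds [ProperSpace X] (hX : IsGeodesicSpace X) (hne : C.Nonempty)
    (hC : IsCompact C) : ∃ Φ : FilteredEnds C ≃ RayEnds X,
      ∀ (σ : ℝ≥0) (A : EndsAtScale C σ) (ρ : ProperRay X),
        Φ (FilteredEnds.mk A) = RayEnds.mk ρ ↔ A.Receives ρ := by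
  have hmk : ∀ {ρ ρ' : ProperRay X}, RayEnds.mk ρ = RayEnds.mk ρ' ↔ ρ.SameEnd ρ' :=
    ⟨fun h => Quotient.exact h, fun h => Quotient.sound h⟩
  obtain ⟨Φ, hΦ⟩ := FilteredEnds.exists_equiv_of_rel (C := C) (T := RayEnds X)
    (fun A e => ∃ ρ, RayEnds.mk ρ = e ∧ A.Receives ρ)
    (fun A => by
      obtain ⟨ρ, hρ⟩ := A.exists_receives hX.hasShortPaths hne
      exact ⟨_, ρ, rfl, hρ⟩)
    (fun e => by
      obtain ⟨ρ, rfl⟩ := Quotient.exists_rep e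
      obtain ⟨A, hA⟩ := ρ.exists_received hC
      exact ⟨1, A, ρ, rfl, hA⟩)
    (by
      rintro σ τ A B _ _ ⟨ρ, rfl, hA⟩ ⟨ρ', rfl, hB⟩
      rw [hmk]
      constructor
      · intro h
        obtain ⟨κ, h1, h2, heq⟩ := FilteredEnds.mk_eq_mk_iff.1 h
        exact ProperRay.sameEnd_of_receives hX.hasShortPaths hne (hA.transition h1)
          (heq ▸ hB.transition h2)
      · exact fun h => (hA.of_sameEnd hC h).mk_eq_mk hB)
  refine ⟨Φ, fun σ A ρ => ?_⟩
  obtain ⟨ρ', hρ', hA⟩ := hΦ A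
  rw [← hρ', hmk]
  exact ⟨fun h => hA.of_sameEnd hC h,
    fun h => ProperRay.sameEnd_of_receives hX.hasShortPaths hne hA h⟩

end Rays

/-! ### Short paths in the Cayley graph -/

section CayleyPaths

variable {G : Type u} [Group G] {S : Set G} {hS : Subgroup.closure S = ⊤}

namespace CayleySpace

open GraphRealization

theorem dist_le_of_pathOfLength {x y : CayleySpace S hS} {l : ℝ} (h : PathOfLength x y l) :
    dist x y ≤ l :=
  csInf_le (bddBelow_lengths x y) h

theorem dist_le_of_mem_closedEdge {x y : CayleySpace S hS} {u v : G}
    (h : (SimpleGraph.mulCayley S).Adj u v) (hx : x.coord ∈ closedEdge u v)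
    (hy : y.coord ∈ closedEdge u v) : dist x y ≤ |x.coord u - y.coord u| := by
  have := dist_le_of_pathOfLength (hS := hS) (.cons h hx hy (.nil y))
  rwa [add_zero] at this

/-- The affine segment between two points of a closed edge. -/
noncomputable def edgeSegment {x y : CayleySpace S hS} {u v : G}
    (h : (SimpleGraph.mulCayley S).Adj u v) (hx : x.coord ∈ closedEdge u v)
    (hy : y.coord ∈ closedEdge u v) (t : unitInterval) : CayleySpace S hS :=
  ⟨AffineMap.lineMap x.coord y.coord (t : ℝ), u, v, Or.inr h,
    (convex_segment _ _).lineMap_mem hx hy t.2⟩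

section

variable {x y : CayleySpace S hS} {u v : G} (h : (SimpleGraph.mulCayley S).Adj u v)
  (hx : x.coord ∈ closedEdge u v) (hy : y.coord ∈ closedEdge u v)

theorem edgeSegment_mem (t : unitInterval) : (edgeSegment h hx hy t).coord ∈ closedEdge u v :=
  (convex_segment _ _).lineMap_mem hx hy t.2

theorem edgeSegment_coord (t : unitInterval) (w : G) :
    (edgeSegment h hx hy t).coord w = x.coord w + t * (y.coord w - x.coord w) := by
  simp [edgeSegment, AffineMap.lineMap_apply]
  ring

theorem edgeSegment_zero : edgeSegment h hx hy 0 = x := by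
  apply GraphRealization.ext
  ext w
  simp [edgeSegment_coord]

theorem edgeSegment_one : edgeSegment h hx hy 1 = y := by
  apply GraphRealization.ext
  ext w
  simp [edgeSegment_coord]

theorem dist_edgeSegment_le (s t : unitInterval) :
    dist (edgeSegment h hx hy s) (edgeSegment h hx hy t) ≤
      |x.coord u - y.coord u| * dist s t := by
  refine (dist_le_of_mem_closedEdge h (edgeSegment_mem h hx hy s)
    (edgeSegment_mem h hx hy t)).trans (le_of_eq ?_)
  rw [edgeSegment_coord, edgeSegment_coord, Subtype.dist_eq, Real.dist_eq, ← abs_mul,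
    ← abs_neg]
  congr 1
  ring

theorem continuous_edgeSegment : Continuous (edgeSegment h hx hy) :=
  (LipschitzWith.of_dist_le_mul (K := ⟨_, abs_nonneg (x.coord u - y.coord u)⟩)
    (dist_edgeSegment_le h hx hy)).continuous

end

theorem joinedIn_of_mem_closedEdge {x y : CayleySpace S hS} {u v : G}
    (h : (SimpleGraph.mulCayley S).Adj u v) (hx : x.coord ∈ closedEdge u v)
    (hy : y.coord ∈ closedEdge u v) :
    JoinedIn (Metric.closedBall x |x.coord u - y.coord u|) x y := by
  refine ⟨⟨⟨edgeSegment h hx hy, continuous_edgeSegment h hx hy⟩, edgeSegment_zero h hx hy,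
    edgeSegment_one h hx hy⟩, fun t => ?_⟩
  change dist (edgeSegment h hx hy t) x ≤ _
  have h1 := dist_edgeSegment_le h hx hy t 0
  rw [edgeSegment_zero] at h1
  refine h1.trans (mul_le_of_le_one_right (abs_nonneg _) ?_)
  rw [Subtype.dist_eq, Real.dist_eq, Icc.coe_zero, sub_zero, abs_of_nonneg t.2.1]
  exact t.2.2

theorem joinedIn_of_pathOfLength {x y : CayleySpace S hS} {l : ℝ} (h : PathOfLength x y l) :
    JoinedIn (Metric.closedBall x l) x y := by
  induction h with
  | nil x => exact .refl (Metric.mem_closedBall_self le_rfl)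
  | @cons x y z u v l a b c h ih =>
    have h1 := joinedIn_of_mem_closedEdge (hS := hS) a b c
    refine (h1.mono (Metric.closedBall_subset_closedBall ?_)).trans
      (ih.mono (Metric.closedBall_subset_closedBall' ?_))
    · linarith [h.nonneg]
    · have h2 := dist_le_of_mem_closedEdge (hS := hS) a b c
      have h3 := dist_comm (α := CayleySpace S hS) x y
      linarith

theorem hasShortPaths : HasShortPaths (CayleySpace S hS) := by
  intro x y
  have hne : {l | PathOfLength x y l}.Nonempty :=
    PathOfLength.exists_of_connected (mulCayley_connected S hS) x y
  obtain ⟨l, hl, hlt⟩ := exists_lt_of_csInf_lt hne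
    (show sInf {l | PathOfLength x y l} < dist x y + 1 from lt_add_one _)
  exact (joinedIn_of_pathOfLength hl).mono (Metric.closedBall_subset_closedBall hlt.le)

theorem isCompact_closedEdge {u v : G} (h : u = v ∨ (SimpleGraph.mulCayley S).Adj u v) :
    IsCompact {x : CayleySpace S hS | x.coord ∈ closedEdge u v} := by
  rcases h with rfl | h
  · refine Set.Subsingleton.isCompact fun x hx y hy => GraphRealization.ext ?_
    simp only [closedEdge, segment_same, mem_ofPred_eq, mem_singleton_iff] at hx hy
    rw [hx, hy]
  · have hu : (vertex S hS u).coord ∈ closedEdge u v := left_mem_segment ℝ _ _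
    have hv : (vertex S hS v).coord ∈ closedEdge u v := right_mem_segment ℝ _ _
    convert isCompact_range (continuous_edgeSegment h hu hv) using 1
    ext x
    constructor
    · intro hx
      have hx' : x.coord ∈ segment ℝ (Finsupp.single u (1 : ℝ)) (Finsupp.single v 1) := hx
      rw [segment_eq_image_lineMap] at hx'
      obtain ⟨t, ht, htx⟩ := hx'
      exact ⟨⟨t, ht⟩, GraphRealization.ext htx⟩
    · rintro ⟨t, rfl⟩
      exact edgeSegment_mem h hu hv t

theorem dist_vertex_le_length {u v : G} (w : (SimpleGraph.mulCayley S).Walk u v) :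
    dist (vertex S hS u) (vertex S hS v) ≤ w.length := by
  induction w with
  | nil => simp
  | @cons a b c h w ih =>
    refine (dist_triangle _ (vertex S hS b) _).trans ?_
    have h1 := dist_le_of_mem_closedEdge (x := vertex S hS a) (y := vertex S hS b) h
      (left_mem_segment ℝ _ _) (right_mem_segment ℝ _ _)
    have h2 : |(vertex S hS a).coord a - (vertex S hS b).coord a| = 1 := by
      simp [vertex, GraphRealization.vertex, h.ne]
    rw [SimpleGraph.Walk.length_cons]
    push_cast
    linarith

end CayleySpace

end CayleyPaths

/-! ### The distance to a subgroup -/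

section Depth

variable {G : Type u} [Group G]

/-- The distance from `g` to the subgroup `P` in the Cayley graph, measured by walks. -/
noncomputable def wordDepth (S : Set G) (P : Subgroup G) (g : G) : ℕ :=
  sInf {n | ∃ p ∈ P, ∃ w : (SimpleGraph.mulCayley S).Walk p g, w.length = n}

variable {S : Set G} {P : Subgroup G}

theorem wordDepth_le {p g : G} (hp : p ∈ P) (w : (SimpleGraph.mulCayley S).Walk p g) :
    wordDepth S P g ≤ w.length :=
  Nat.sInf_le ⟨p, hp, w, rfl⟩

theorem exists_walk_length_eq_wordDepth (hS : Subgroup.closure S = ⊤) (P : Subgroup G) (g : G) :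
    ∃ p ∈ P, ∃ w : (SimpleGraph.mulCayley S).Walk p g, w.length = wordDepth S P g := by
  obtain ⟨w⟩ := (mulCayley_connected S hS).preconnected 1 g
  exact Nat.sInf_mem (s := {n | ∃ p ∈ P, ∃ w : (SimpleGraph.mulCayley S).Walk p g, w.length = n})
    ⟨_, 1, P.one_mem, w, rfl⟩

theorem wordDepth_le_succ (hS : Subgroup.closure S = ⊤) {u v : G}
    (h : (SimpleGraph.mulCayley S).Adj u v) : wordDepth S P v ≤ wordDepth S P u + 1 := by
  obtain ⟨p, hp, w, hw⟩ := exists_walk_length_eq_wordDepth hS P u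
  rw [← hw]
  simpa using wordDepth_le hp (w.concat h)

theorem exists_walk_mul_left (p : G) {a b : G} (w : (SimpleGraph.mulCayley S).Walk a b) :
    ∃ w' : (SimpleGraph.mulCayley S).Walk (p * a) (p * b), w'.length = w.length ∧
      ∀ g ∈ w'.support, ∃ g₀ ∈ w.support, p * g₀ = g := by
  let f : SimpleGraph.mulCayley S →g SimpleGraph.mulCayley S :=
    ⟨(p * ·), mulCayley_adj_mul_left S p⟩
  refine ⟨w.map f, SimpleGraph.Walk.length_map f w, fun g hg => ?_⟩
  have hg' : g ∈ w.support.map f := by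
    rw [← SimpleGraph.Walk.support_map]
    exact hg
  exact List.mem_map.1 hg'

theorem wordDepth_mul_le (hS : Subgroup.closure S = ⊤) {p : G} (hp : p ∈ P) (g : G) :
    wordDepth S P (p * g) ≤ wordDepth S P g := by
  obtain ⟨q, hq, w, hw⟩ := exists_walk_length_eq_wordDepth hS P g
  obtain ⟨w', hw', -⟩ := exists_walk_mul_left p w
  exact (wordDepth_le (P.mul_mem hp hq) w').trans (hw'.trans hw).le

theorem wordDepth_mul (hS : Subgroup.closure S = ⊤) {p : G} (hp : p ∈ P) (g : G) :
    wordDepth S P (p * g) = wordDepth S P g := by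
  refine le_antisymm (wordDepth_mul_le hS hp g) ?_
  simpa using wordDepth_mul_le hS (P.inv_mem hp) (p * g)

theorem wordDepth_of_mem {p : G} (hp : p ∈ P) : wordDepth S P p = 0 := by
  simpa using wordDepth_le (S := S) hp .nil

theorem wordDepth_le_of_mem_support {p g v : G} (hp : p ∈ P)
    (w : (SimpleGraph.mulCayley S).Walk p g) (hv : v ∈ w.support) : wordDepth S P v ≤ w.length := by
  classical
  exact (wordDepth_le hp (w.takeUntil v hv)).trans (w.length_takeUntil_le_length hv)

/-- The extension of `wordDepth` to the Cayley graph that is affine on the edges. -/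
noncomputable def CayleySpace.depth {hS : Subgroup.closure S = ⊤} (P : Subgroup G)
    (x : CayleySpace S hS) : ℝ :=
  Finsupp.linearCombination ℝ (fun g => (wordDepth S P g : ℝ)) x.coord

namespace CayleySpace

open GraphRealization

variable {hS : Subgroup.closure S = ⊤}

theorem depth_vertex (P : Subgroup G) (g : G) : depth P (vertex S hS g) = wordDepth S P g := by
  simp [depth, vertex, GraphRealization.vertex]

theorem coord_smul (g : G) (x : CayleySpace S hS) :
    (g • x).coord = Finsupp.mapDomain (g * ·) x.coord :=
  rfl

theorem depth_smul {p : G} (hp : p ∈ P) (x : CayleySpace S hS) : depth P (p • x) = depth P x := by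
  rw [depth, coord_smul, Finsupp.linearCombination_mapDomain]
  simp only [depth, Function.comp_def, wordDepth_mul hS hp]

theorem abs_depth_sub_le {x y : CayleySpace S hS} {l : ℝ} (h : PathOfLength x y l) :
    |depth P x - depth P y| ≤ l := by
  induction h with
  | nil => simp
  | @cons x y z u v l a b c _ ih =>
    refine (abs_sub_le _ (depth (hS := hS) P y) _).trans (add_le_add ?_ ih)
    obtain ⟨s, t, -, -, hst, hx⟩ := b
    obtain ⟨s', t', -, -, hst', hy⟩ := c
    have h1 : wordDepth S P v ≤ wordDepth S P u + 1 := wordDepth_le_succ hS a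
    have h2 : wordDepth S P u ≤ wordDepth S P v + 1 := wordDepth_le_succ hS a.symm
    have h3 : |(wordDepth S P u : ℝ) - wordDepth S P v| ≤ 1 := by
      have h1' : (wordDepth S P v : ℝ) ≤ wordDepth S P u + 1 := by exact_mod_cast h1
      have h2' : (wordDepth S P u : ℝ) ≤ wordDepth S P v + 1 := by exact_mod_cast h2
      exact abs_le.2 ⟨by linarith, by linarith⟩
    have h4 : x.coord u - y.coord u = s - s' := by
      rw [← hx, ← hy]
      simp [a.ne]
    have h5 : depth (hS := hS) P x - depth (hS := hS) P y =
        (s - s') * ((wordDepth S P u : ℝ) - wordDepth S P v) := by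
      unfold depth
      rw [← hx, ← hy]
      simp only [map_add, map_smul, Finsupp.linearCombination_single, smul_eq_mul, one_mul]
      rw [show t = 1 - s by linarith, show t' = 1 - s' by linarith]
      ring
    rw [h4, h5, abs_mul]
    exact mul_le_of_le_one_right (abs_nonneg _) h3

theorem abs_depth_sub_le_dist (P : Subgroup G) (x y : CayleySpace S hS) :
    |depth P x - depth P y| ≤ dist x y :=
  le_csInf (PathOfLength.exists_of_connected (mulCayley_connected S hS) x y)
    fun _ hl => abs_depth_sub_le (hS := hS) hl

theorem continuous_depth (P : Subgroup G) : Continuous (depth (hS := hS) P) :=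
  (LipschitzWith.of_dist_le_mul (K := 1) fun x y => by
    simpa [Real.dist_eq] using abs_depth_sub_le_dist P x y).continuous

/-- The endpoints of the edge containing `x` have depth within `1` of that of `x`. -/
theorem wordDepth_le_depth {u v : G} (h : u = v ∨ (SimpleGraph.mulCayley S).Adj u v)
    {x : CayleySpace S hS} (hx : x.coord ∈ closedEdge u v) :
    (wordDepth S P u : ℝ) ≤ depth P x + 1 := by
  obtain ⟨s, t, hs, ht, hst, hx⟩ := hx
  have h1 : (wordDepth S P u : ℝ) ≤ wordDepth S P v + 1 := by
    rcases h with rfl | h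
    · linarith
    · exact_mod_cast wordDepth_le_succ hS h.symm
  rw [depth, ← hx]
  simp only [map_add, map_smul, Finsupp.linearCombination_single, smul_eq_mul, one_mul]
  obtain rfl : s = 1 - t := by linarith
  have h2 := mul_le_mul_of_nonneg_left h1 ht
  nlinarith

theorem dist_vertex_le_one {u v : G} (h : u = v ∨ (SimpleGraph.mulCayley S).Adj u v)
    {x : CayleySpace S hS} (hx : x.coord ∈ closedEdge u v) : dist x (vertex S hS u) ≤ 1 := by
  have hu : (vertex S hS u).coord ∈ closedEdge u v := left_mem_segment ℝ _ _
  rcases h with rfl | h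
  · have : x = vertex S hS u := by
      apply GraphRealization.ext
      simpa [closedEdge, segment_same, vertex, GraphRealization.vertex] using hx
    rw [this, dist_self]
    exact zero_le_one
  · refine (dist_le_of_mem_closedEdge h hx hu).trans ?_
    obtain ⟨s, t, hs, ht, hst, hx⟩ := hx
    rw [← hx]
    simp only [vertex, GraphRealization.vertex, Finsupp.coe_add, Finsupp.coe_smul, Pi.add_apply,
      Pi.smul_apply, Finsupp.single_eq_same, smul_eq_mul, mul_one,
      Finsupp.single_eq_of_ne h.ne, mul_zero, add_zero]
    exact abs_le.2 ⟨by linarith, by linarith⟩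

theorem exists_dist_le_depth (P : Subgroup G) (x : CayleySpace S hS) :
    ∃ p ∈ P, dist x (vertex S hS p) ≤ depth P x + 2 := by
  obtain ⟨u, v, h, hx⟩ := x.mem
  obtain ⟨p, hp, w, hw⟩ := exists_walk_length_eq_wordDepth hS P u
  refine ⟨p, hp, ?_⟩
  have h1 := dist_vertex_le_one h hx
  have h2 := dist_vertex_le_length (hS := hS) w
  rw [hw, dist_comm] at h2
  have h3 := wordDepth_le_depth (P := P) h hx
  have h4 := dist_triangle x (vertex S hS u) (vertex S hS p)
  linarith

theorem depth_lt_of_notMem_outside {μ : ℝ≥0} {x : CayleySpace S hS}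
    (hx : x ∉ outside (vertex S hS '' (P : Set G)) μ) : depth P x < μ := by
  rw [mem_outside] at hx
  push Not at hx
  obtain ⟨_, ⟨p, hp, rfl⟩, hx⟩ := hx
  have h1 := (abs_le.1 (abs_depth_sub_le_dist P x (vertex S hS p))).2
  rw [depth_vertex, wordDepth_of_mem hp] at h1
  push_cast at h1
  linarith

theorem outside_subset_lt_depth (P : Subgroup G) {m : ℝ≥0} {r : ℝ} (h : r + 2 < m)
    {x : CayleySpace S hS} (hx : x ∈ outside (vertex S hS '' (P : Set G)) m) : r < depth P x := by
  obtain ⟨p, hp, hxp⟩ := exists_dist_le_depth P x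
  have h1 := mem_outside.1 hx _ ⟨p, hp, rfl⟩
  linarith

end CayleySpace

end Depth

/-! ### Cocompact subgraphs -/

section Cocompact

variable {G : Type u} [Group G] {S : Set G}

/-- The full subgraph of the Cayley graph on the vertices at distance at most `n` from `P`. -/
def depthSubgraph (S : Set G) (P : Subgroup G) (n : ℕ) : (SimpleGraph.mulCayley S).Subgraph :=
  (⊤ : (SimpleGraph.mulCayley S).Subgraph).induce {g | wordDepth S P g ≤ n}

theorem depthSubgraph_mono (S : Set G) (P : Subgroup G) {m n : ℕ} (h : m ≤ n) :
    depthSubgraph S P m ≤ depthSubgraph S P n :=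
  SimpleGraph.Subgraph.induce_mono_right fun _ hg => le_trans (show wordDepth S P _ ≤ m from hg) h

theorem depthSubgraph_adj_mul (hS : Subgroup.closure S = ⊤) {P : Subgroup G} {n : ℕ} {p u v : G}
    (hp : p ∈ P) (h : (depthSubgraph S P n).Adj u v) :
    (depthSubgraph S P n).Adj (p * u) (p * v) :=
  ⟨(wordDepth_mul_le hS hp u).trans h.fst_mem, (wordDepth_mul_le hS hp v).trans h.snd_mem,
    mulCayley_adj_mul_left S p h.adj_sub⟩

theorem finite_setOf_walk_length_eq (hfin : S.Finite) (n : ℕ) (a : G) :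
    {g | ∃ w : (SimpleGraph.mulCayley S).Walk a g, w.length = n}.Finite := by
  induction n generalizing a with
  | zero =>
    refine (finite_singleton a).subset ?_
    rintro g ⟨w, hw⟩
    exact (SimpleGraph.Walk.eq_of_length_eq_zero hw).symm
  | succ n ih =>
    have hnb : {b | (SimpleGraph.mulCayley S).Adj a b}.Finite := by
      refine ((hfin.image (a * ·)).union (hfin.image (a * ·⁻¹))).subset ?_
      intro b hb
      obtain ⟨-, s, hs, h | h⟩ := (SimpleGraph.mulCayley_adj' S _ _).1 hb
      · exact Or.inl ⟨s, hs, h⟩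
      · exact Or.inr ⟨s, hs, by simp [h]⟩
    refine (hnb.biUnion fun b _ => ih b).subset ?_
    rintro g ⟨w, hw⟩
    cases w with
    | nil => simp at hw
    | @cons _ b _ h w => exact mem_biUnion h ⟨w, by simpa using hw⟩

theorem finite_setOf_walk_length_le (hfin : S.Finite) (n : ℕ) (a : G) :
    {g | ∃ w : (SimpleGraph.mulCayley S).Walk a g, w.length ≤ n}.Finite := by
  refine ((finite_Iic n).biUnion fun k _ => finite_setOf_walk_length_eq hfin k a).subset ?_
  rintro g ⟨w, hw⟩
  exact mem_biUnion (show w.length ∈ Iic n from hw) ⟨w, rfl⟩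

/-- `depthSubgraph S P n` is connected as soon as it contains paths from `1` to the elements of a
finite generating set of `P`. -/
theorem exists_connected_depthSubgraph (hS : Subgroup.closure S = ⊤) {P : Subgroup G}
    (hP : P.FG) : ∃ n₀, ∀ n, n₀ ≤ n → (depthSubgraph S P n).Connected := by
  obtain ⟨Q, hQ⟩ := hP
  let w : ∀ q : G, (SimpleGraph.mulCayley S).Walk 1 q := fun q =>
    ((mulCayley_connected S hS).preconnected 1 q).some
  refine ⟨Q.sup fun q => (w q).length, fun n hn => ?_⟩
  let J : G → G → Prop := fun a b =>
    ∃ v : (SimpleGraph.mulCayley S).Walk a b, ∀ g ∈ v.support, wordDepth S P g ≤ n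
  have hsymm : ∀ {a b}, J a b → J b a := fun ⟨v, hv⟩ => ⟨v.reverse, by simpa using hv⟩
  have htrans : ∀ {a b c}, J a b → J b c → J a c := fun ⟨v, hv⟩ ⟨v', hv'⟩ =>
    ⟨v.append v', fun g hg => by
      rcases SimpleGraph.Walk.mem_support_append_iff .. |>.1 hg with h | h
      exacts [hv g h, hv' g h]⟩
  have hmul : ∀ {a b p}, p ∈ P → J a b → J (p * a) (p * b) := by
    rintro a b p hp ⟨v, hv⟩
    obtain ⟨v', -, hv'⟩ := exists_walk_mul_left p v
    refine ⟨v', fun g hg => ?_⟩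
    obtain ⟨g₀, hg₀, rfl⟩ := hv' g hg
    exact (wordDepth_mul_le hS hp g₀).trans (hv g₀ hg₀)
  have hwalk : ∀ {p g} (v : (SimpleGraph.mulCayley S).Walk p g), p ∈ P → v.length ≤ n → J p g :=
    fun v hp hv => ⟨v, fun g hg => (wordDepth_le_of_mem_support hp v hg).trans hv⟩
  have hone : ∀ p ∈ P, J 1 p := by
    suffices ∀ p, p ∈ Subgroup.closure (Q : Set G) → p ∈ P ∧ J 1 p from
      fun p hp => (this p (hQ ▸ hp)).2
    intro p hp
    refine ⟨hQ ▸ hp, ?_⟩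
    induction hp using Subgroup.closure_induction with
    | mem q hq =>
      exact hwalk (w q) P.one_mem ((Finset.le_sup (f := fun q => (w q).length) hq).trans hn)
    | one => exact hwalk .nil P.one_mem (Nat.zero_le n)
    | mul x y hx _ ihx ihy =>
      exact htrans ihx (by simpa using hmul (hQ ▸ hx : x ∈ P) ihy)
    | inv x hx ih => exact hsymm (by simpa using hmul (P.inv_mem (hQ ▸ hx : x ∈ P)) ih)
  rw [depthSubgraph, ← SimpleGraph.connected_induce_iff]
  refine (SimpleGraph.connected_iff_exists_forall_reachable _).2
    ⟨⟨1, by simp [wordDepth_of_mem P.one_mem]⟩, ?_⟩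
  rintro ⟨g, hg⟩
  obtain ⟨p, hp, v, hv⟩ := exists_walk_length_eq_wordDepth hS P g
  obtain ⟨v', hv'⟩ := htrans (hone p hp) (hwalk v hp (hv.trans_le hg))
  exact ⟨v'.induce _ hv'⟩

namespace CayleySpace

open GraphRealization

variable {hS : Subgroup.closure S = ⊤} {P : Subgroup G}

theorem ofSubgraph_mono {A B : (SimpleGraph.mulCayley S).Subgraph} (h : A ≤ B) :
    ofSubgraph S hS A ⊆ ofSubgraph S hS B := by
  rintro x ⟨u, v, huv, hx⟩
  exact ⟨u, v, huv.imp (And.imp_right fun hu => h.1 hu) fun huv => h.2 huv, hx⟩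

theorem vertex_mem_ofSubgraph {A : (SimpleGraph.mulCayley S).Subgraph} {g : G} (hg : g ∈ A.verts) :
    vertex S hS g ∈ ofSubgraph S hS A :=
  ⟨g, g, Or.inl ⟨rfl, hg⟩, left_mem_segment ℝ _ _⟩

/-- Every edge through a point of depth at most `n` belongs to `depthSubgraph S P (n + 1)`. -/
theorem mem_ofSubgraph_depthSubgraph {n : ℕ} {x : CayleySpace S hS} (hx : depth P x ≤ n) :
    x ∈ ofSubgraph S hS (depthSubgraph S P (n + 1)) := by
  obtain ⟨u, v, h, hxuv⟩ := x.mem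
  have hbound : ∀ a b, (a = b ∨ (SimpleGraph.mulCayley S).Adj a b) →
      x.coord ∈ closedEdge a b → wordDepth S P a ≤ n + 1 := fun a b hab hxab => by
    have h1 := wordDepth_le_depth (P := P) hab hxab
    have h2 : (wordDepth S P a : ℝ) ≤ n + 1 := by linarith
    exact_mod_cast h2
  have hu := hbound u v h hxuv
  rcases h with rfl | h
  · exact ⟨u, u, Or.inl ⟨rfl, hu⟩, hxuv⟩
  · have hv := hbound v u (Or.inr h.symm) (by rwa [closedEdge, segment_symm])
    exact ⟨u, v, Or.inr ⟨hu, hv, h⟩, hxuv⟩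

theorem compl_ofSubgraph_depthSubgraph_subset (n : ℕ) :
    (ofSubgraph S hS (depthSubgraph S P (n + 1)))ᶜ ⊆ outside (vertex S hS '' (P : Set G)) n := by
  intro x hx
  by_contra h
  have := depth_lt_of_notMem_outside h
  push_cast at this
  exact hx (mem_ofSubgraph_depthSubgraph this.le)

/-- Up to translation by `P` there are only finitely many edges near `P`. -/
theorem isCompact_image_depthSubgraph (hfin : S.Finite) (n : ℕ) :
    IsCompact ((Quotient.mk (MulAction.orbitRel P (CayleySpace S hS))) ''
      ofSubgraph S hS (depthSubgraph S P n)) := by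
  let F : Set (G × G) := {e | (∃ w : (SimpleGraph.mulCayley S).Walk 1 e.1, w.length ≤ n) ∧
    ((e.1 = e.2 ∧ e.1 ∈ (depthSubgraph S P n).verts) ∨ (depthSubgraph S P n).Adj e.1 e.2)}
  have hF : F.Finite := by
    refine ((finite_setOf_walk_length_le hfin n 1).prod
      (finite_setOf_walk_length_le hfin (n + 1) 1)).subset ?_
    rintro ⟨u, v⟩ ⟨⟨w, hw⟩, h⟩
    refine ⟨⟨w, hw⟩, ?_⟩
    rcases h with ⟨h, -⟩ | h
    · obtain rfl : u = v := h
      exact ⟨w, hw.trans n.le_succ⟩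
    · exact ⟨w.concat h.adj_sub, by simpa using hw⟩
  have hK : IsCompact (⋃ e ∈ F, {x : CayleySpace S hS | x.coord ∈ closedEdge e.1 e.2}) :=
    hF.isCompact_biUnion fun e he => isCompact_closedEdge (he.2.imp And.left fun h => h.adj_sub)
  convert hK.image (continuous_quotient_mk' (s := MulAction.orbitRel P (CayleySpace S hS))) using 1
  apply subset_antisymm
  · rintro _ ⟨x, ⟨u, v, h, hx⟩, rfl⟩
    have hu : wordDepth S P u ≤ n := by
      rcases h with ⟨-, h⟩ | h
      · exact h
      · exact h.fst_mem
    obtain ⟨p, hp, w, hw⟩ := exists_walk_length_eq_wordDepth hS P u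
    obtain ⟨w', hw', -⟩ := exists_walk_mul_left p⁻¹ w
    refine ⟨p⁻¹ • x, mem_biUnion (x := (p⁻¹ * u, p⁻¹ * v)) ⟨⟨w'.copy (inv_mul_cancel p) rfl, ?_⟩,
      ?_⟩ (mapDomain_mem_closedEdge p⁻¹ hx), ?_⟩
    · rw [SimpleGraph.Walk.length_copy, hw', hw]
      exact hu
    · refine Or.imp (And.imp (congrArg _) fun h => ?_) (fun h => ?_) h
      · exact (wordDepth_mul_le hS (P.inv_mem hp) u).trans h
      · exact depthSubgraph_adj_mul hS (P.inv_mem hp) h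
    · exact Quotient.sound ⟨⟨p⁻¹, P.inv_mem hp⟩, rfl⟩
  · refine image_mono (iUnion₂_subset ?_)
    rintro ⟨u, v⟩ ⟨-, h⟩ x hx
    exact ⟨u, v, h, hx⟩

theorem depthSubgraph_mem_cocompactSubgraphs (hfin : S.Finite) {n : ℕ}
    (hconn : (depthSubgraph S P n).Connected) :
    depthSubgraph S P n ∈ cocompactSubgraphs S hS P := by
  refine ⟨hconn.nonempty, hconn, fun p hp v hv => ?_,
    fun p hp u v h => depthSubgraph_adj_mul hS hp h, isCompact_image_depthSubgraph hfin n⟩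
  exact (wordDepth_mul_le hS hp v).trans hv

/-- The depth is a continuous function on the quotient by `P`, so it is bounded on a cocompact
subgraph. -/
theorem exists_depth_le_of_mem_cocompactSubgraphs {B : (SimpleGraph.mulCayley S).Subgraph}
    (hB : B ∈ cocompactSubgraphs S hS P) : ∃ M : ℝ, ∀ x ∈ ofSubgraph S hS B, depth P x ≤ M := by
  let F : Quotient (MulAction.orbitRel P (CayleySpace S hS)) → ℝ :=
    Quotient.lift (depth P) (by
      rintro x y ⟨p, rfl⟩
      exact depth_smul p.2 y)
  have hF : Continuous F := (continuous_depth P).quotient_lift _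
  obtain ⟨M, hM⟩ := (hB.2.2.2.2.image hF).bddAbove
  exact ⟨M, fun x hx => hM ⟨_, ⟨x, hx, rfl⟩, rfl⟩⟩

theorem exists_outside_subset_of_mem_cocompactSubgraphs {B : (SimpleGraph.mulCayley S).Subgraph}
    (hB : B ∈ cocompactSubgraphs S hS P) :
    ∃ m, outside (vertex S hS '' (P : Set G)) m ⊆ (ofSubgraph S hS B)ᶜ := by
  obtain ⟨M, hM⟩ := exists_depth_le_of_mem_cocompactSubgraphs hB
  refine ⟨(M + 3).toNNReal, fun x hx hxB => ?_⟩
  have h1 := Real.le_coe_toNNReal (M + 3)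
  exact absurd (hM x hxB) (not_le.2 (outside_subset_lt_depth P (by linarith) hx))

theorem exists_le_depthSubgraph {B : (SimpleGraph.mulCayley S).Subgraph}
    (hB : B ∈ cocompactSubgraphs S hS P) : ∃ n, B ≤ depthSubgraph S P n := by
  obtain ⟨M, hM⟩ := exists_depth_le_of_mem_cocompactSubgraphs hB
  obtain ⟨n, hn⟩ := exists_nat_ge M
  have hverts : ∀ g ∈ B.verts, wordDepth S P g ≤ n := fun g hg => by
    have h1 := (hM _ (vertex_mem_ofSubgraph hg)).trans hn
    rw [depth_vertex] at h1
    exact_mod_cast h1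
  exact ⟨n, hverts, fun u v h => ⟨hverts u h.fst_mem, hverts v h.snd_mem, h.adj_sub⟩⟩

/-- The cocompact subgraphs have a cofinal increasing sequence that exhausts the neighbourhoods
of `P`. -/
theorem exists_cofinal_cocompactSubgraphs (hfin : S.Finite) (hP : P.FG) :
    ∃ N : ℕ → cocompactSubgraphs S hS P, (∀ m n, m ≤ n → (N m).1 ≤ (N n).1) ∧
      (∀ B : cocompactSubgraphs S hS P, ∃ n, B.1 ≤ (N n).1) ∧
      ∀ n : ℕ, (ofSubgraph S hS (N n).1)ᶜ ⊆ outside (vertex S hS '' (P : Set G)) n := by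
  obtain ⟨n₀, hn₀⟩ := exists_connected_depthSubgraph hS hP
  refine ⟨fun n => ⟨depthSubgraph S P (n + n₀ + 1),
    depthSubgraph_mem_cocompactSubgraphs hfin (hn₀ _ (by omega))⟩,
    fun m n h => depthSubgraph_mono S P (by omega), fun B => ?_, fun n => ?_⟩
  · obtain ⟨n, hn⟩ := exists_le_depthSubgraph B.2
    exact ⟨n, hn.trans (depthSubgraph_mono S P (by omega))⟩
  · exact (compl_ofSubgraph_depthSubgraph_subset (n + n₀)).trans (outside_anti _ (by simp))

end CayleySpace

end Cocompact

/-! ### Coends -/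

section CoendsEquiv

variable {G : Type u} [Group G] {S : Set G} {hS : Subgroup.closure S = ⊤} {P : Subgroup G}
  {σ τ : ℝ≥0}

open CayleySpace

namespace Coends

variable (K : Coends S hS P) (B : cocompactSubgraphs S hS P)

theorem isPreconnected : IsPreconnected (K.1 B) := by
  obtain ⟨⟨x, -, h⟩, -⟩ := K.2.1 B
  rw [h]
  exact isPreconnected_connectedComponentIn

theorem subset_compl : K.1 B ⊆ (ofSubgraph S hS B.1)ᶜ := by
  obtain ⟨⟨x, -, h⟩, -⟩ := K.2.1 B
  rw [h]
  exact connectedComponentIn_subset _ _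

theorem nonempty : (K.1 B).Nonempty := by
  obtain ⟨⟨x, hx, h⟩, -⟩ := K.2.1 B
  rw [h]
  exact ⟨x, mem_connectedComponentIn hx⟩

theorem eq_connectedComponentIn {x : CayleySpace S hS} (hx : x ∈ K.1 B) :
    K.1 B = connectedComponentIn (ofSubgraph S hS B.1)ᶜ x := by
  obtain ⟨⟨y, -, h⟩, -⟩ := K.2.1 B
  rw [h] at hx ⊢
  exact connectedComponentIn_eq hx

end Coends

/-- The end `A` lies in the coend `K`: every component of `K` contains some component of `A`. -/
def EndsAtScale.LiesIn (A : EndsAtScale (vertex S hS '' (P : Set G)) σ) (K : Coends S hS P) :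
    Prop :=
  ∀ B, ∃ μ, A.comp μ ⊆ K.1 B

namespace EndsAtScale

theorem LiesIn.coend_eq {A : EndsAtScale (vertex S hS '' (P : Set G)) σ} {K K' : Coends S hS P}
    (h : A.LiesIn K) (h' : A.LiesIn K') : K = K' := by
  refine Subtype.ext (funext fun B => ?_)
  obtain ⟨μ, hμ⟩ := h B
  obtain ⟨ν, hν⟩ := h' B
  obtain ⟨x, hx⟩ := A.comp_nonempty (max μ ν)
  rw [K.eq_connectedComponentIn B (hμ (A.anti _ _ (le_max_left _ _) hx)),
    K'.eq_connectedComponentIn B (hν (A.anti _ _ (le_max_right _ _) hx))]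

theorem LiesIn.of_transition {A : EndsAtScale (vertex S hS '' (P : Set G)) σ}
    {K : Coends S hS P} (h : σ ≤ τ) (hA : (transition h A).LiesIn K) : A.LiesIn K := fun B => by
  obtain ⟨μ, hμ⟩ := hA B
  exact ⟨μ, (A.subset_transition h μ).trans hμ⟩

/-- Deep components of an end avoid `B`, and the coarse paths in them can be filled without
meeting `B`. -/
theorem exists_liesIn (A : EndsAtScale (vertex S hS '' (P : Set G)) σ) :
    ∃ K : Coends S hS P, A.LiesIn K := by
  choose m hm using fun B : cocompactSubgraphs S hS P =>
    exists_outside_subset_of_mem_cocompactSubgraphs B.2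
  choose a ha using fun B => A.comp_nonempty (m B + (σ + 1))
  have hsub : ∀ B, A.comp (m B + (σ + 1)) ⊆
      connectedComponentIn (ofSubgraph S hS B.1)ᶜ (a B) := by
    intro B y hy
    obtain ⟨γ, hγ⟩ := A.joinedIn hasShortPaths (ha B) hy
    refine (isPreconnected_range γ.continuous).subset_connectedComponentIn ⟨0, γ.source⟩ ?_
      ⟨1, γ.target⟩
    rintro _ ⟨t, rfl⟩
    exact hm B (hγ t)
  refine ⟨⟨fun B => connectedComponentIn (ofSubgraph S hS B.1)ᶜ (a B), fun B =>
    ⟨⟨a B, hm B (outside_anti _ le_self_add (A.subset_outside _ (ha B))), rfl⟩, ?_⟩, ?_⟩,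
    fun B => ⟨_, hsub B⟩⟩
  · intro B' hB' hle
    obtain ⟨x, hx⟩ := A.comp_nonempty (max (m B + (σ + 1)) (m ⟨B', hB'⟩))
    exact hm ⟨B', hB'⟩ (A.subset_outside _ (A.anti _ _ (le_max_right _ _) hx))
      (hle (hsub B (A.anti _ _ (le_max_left _ _) hx)))
  · intro B B' hBB'
    obtain ⟨x, hx⟩ := A.comp_nonempty (max (m B + (σ + 1)) (m B' + (σ + 1)))
    have h1 := hsub B (A.anti _ _ (le_max_left _ _) hx)
    have h2 := hsub B' (A.anti _ _ (le_max_right _ _) hx)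
    change connectedComponentIn (ofSubgraph S hS B'.1)ᶜ (a B') ⊆
      connectedComponentIn (ofSubgraph S hS B.1)ᶜ (a B)
    rw [connectedComponentIn_eq h1]
    exact isPreconnected_connectedComponentIn.subset_connectedComponentIn h2
      ((connectedComponentIn_subset _ _).trans (compl_subset_compl.2 (ofSubgraph_mono hBB')))

end EndsAtScale

/-- Every coend contains an end: an essential component is unbounded, since it is not contained in
any neighbourhood of `P`. -/
theorem Coends.exists_liesIn (hfin : S.Finite) (hP : P.FG) (K : Coends S hS P) :
    ∃ A : EndsAtScale (vertex S hS '' (P : Set G)) 1, A.LiesIn K := by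
  obtain ⟨N, hN, hcof, hout⟩ := exists_cofinal_cocompactSubgraphs (hS := hS) hfin hP
  have hsub : ∀ n : ℕ, ∀ μ : ℝ≥0, μ ≤ n → K.1 (N n) ⊆ outside (vertex S hS '' (P : Set G)) μ :=
    fun n μ h => (K.subset_compl (N n)).trans ((hout n).trans (outside_anti _ h))
  have hT : ∀ μ : ℝ≥0, K.1 (N ⌈μ⌉₊) ⊆ outside (vertex S hS '' (P : Set G)) μ :=
    fun μ => hsub _ μ (Nat.le_ceil μ)
  obtain ⟨A, hA⟩ := EndsAtScale.exists_of_system (C := vertex S hS '' (P : Set G)) (σ := 1)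
    (T := fun μ => K.1 (N ⌈μ⌉₊)) (fun μ ν h => K.2.2 _ _ (hN _ _ (Nat.ceil_mono h))) hT
    (fun μ => K.nonempty _)
    (fun μ hb => by
      obtain ⟨m, hm⟩ := exists_outside_subset_compl
        (⟨_, 1, P.one_mem, rfl⟩ : (vertex S hS '' (P : Set G)).Nonempty) hb
      refine (K.2.1 (N ⌈μ⌉₊)).2 _ (N ⌈m⌉₊).2 fun x hx => ?_
      by_contra hxN
      exact hm (outside_anti _ (Nat.le_ceil m) (hout _ hxN)) hx)
    (fun μ x hx y hy => (K.isPreconnected _).coarselyJoined (hT μ) one_pos hx hy)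
  obtain ⟨K', hK'⟩ := A.exists_liesIn
  suffices h : K' = K from ⟨A, h ▸ hK'⟩
  refine Subtype.ext (funext fun B => ?_)
  obtain ⟨μ, hμ⟩ := hK' B
  obtain ⟨n, hn⟩ := hcof B
  obtain ⟨x, hx⟩ := K.nonempty (N (max n ⌈μ⌉₊))
  have h1 : x ∈ K.1 B := K.2.2 _ _ (hn.trans (hN _ _ (le_max_left _ _))) hx
  have h2 : x ∈ K'.1 B := hμ (hA μ (K.2.2 _ _ (hN _ _ (le_max_right _ _)) hx))
  rw [K.eq_connectedComponentIn B h1, K'.eq_connectedComponentIn B h2]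

theorem EndsAtScale.LiesIn.mk_eq_mk (hfin : S.Finite) (hP : P.FG) {K : Coends S hS P}
    {A : EndsAtScale (vertex S hS '' (P : Set G)) σ}
    {A' : EndsAtScale (vertex S hS '' (P : Set G)) τ} (hA : A.LiesIn K) (hA' : A'.LiesIn K) :
    FilteredEnds.mk A = FilteredEnds.mk A' := by
  obtain ⟨N, -, -, hout⟩ := exists_cofinal_cocompactSubgraphs (hS := hS) hfin hP
  refine FilteredEnds.mk_eq_mk_of_joined 1 fun ν => ?_
  obtain ⟨l, hl⟩ := hA (N ⌈ν⌉₊)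
  obtain ⟨m, hm⟩ := hA' (N ⌈ν⌉₊)
  obtain ⟨x, hx⟩ := A.comp_nonempty (max ν l)
  obtain ⟨y, hy⟩ := A'.comp_nonempty (max ν m)
  refine ⟨x, A.anti _ _ (le_max_left _ _) hx, y, A'.anti _ _ (le_max_left _ _) hy,
    (K.isPreconnected _).coarselyJoined ?_ one_pos (hl (A.anti _ _ (le_max_right _ _) hx))
      (hm (A'.anti _ _ (le_max_right _ _) hy))⟩
  exact (K.subset_compl _).trans ((hout _).trans (outside_anti _ (Nat.le_ceil ν)))

/-- The filtered ends of a group relative to a finitely generated subgroup correspond to its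
coends. -/
theorem nonempty_filteredEnds_equiv_coends (hfin : S.Finite) (hP : P.FG) :
    Nonempty (FilteredEnds (vertex S hS '' (P : Set G)) ≃ Coends S hS P) := by
  obtain ⟨Φ, -⟩ := FilteredEnds.exists_equiv_of_rel (C := vertex S hS '' (P : Set G))
    (T := Coends S hS P) (fun A K => A.LiesIn K) (fun A => A.exists_liesIn)
    (fun K => ⟨1, K.exists_liesIn hfin hP⟩) (fun A A' K K' hA hA' => by
      constructor
      · intro h
        obtain ⟨κ, h1, h2, heq⟩ := FilteredEnds.mk_eq_mk_iff.1 h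
        obtain ⟨K₀, hK₀⟩ := (EndsAtScale.transition h1 A).exists_liesIn
        exact (hA.coend_eq hK₀.of_transition).trans
          (EndsAtScale.LiesIn.of_transition h2 (heq ▸ hK₀) |>.coend_eq hA')
      · rintro rfl
        exact hA.mk_eq_mk hfin hP hA')
  exact ⟨Φ⟩

end CoendsEquiv

open CategoryTheory in
theorem theorem5p2 :
    ∃ (E : QPMet.{u} ⥤ Type u) (hE : ∀ P : QPMet.{u}, E.obj P = P.Ends),
      -- `Ends(f)` is the function induced by `f` on components
      (∀ (P Q : QPMet.{u}) (f : P ⟶ Q) (σ : ℝ≥0) (A : EndsAtScale P.sub σ),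
        ∃ (τ : ℝ≥0) (B : EndsAtScale Q.sub τ),
          endsMap E hE f (FilteredEnds.mk A) = FilteredEnds.mk B ∧
          ∀ ν : ℝ≥0, ∃ μ : ℝ≥0, f.toFun '' A.comp μ ⊆ B.comp ν) ∧
      -- maps close to the identity
      (∀ (P : QPMet.{u}) (f : P ⟶ P) (r : ℝ), (∀ x, dist (f.toFun x) x ≤ r) →
        ∀ e : P.Ends, endsMap E hE f e = e) ∧
      -- quasi-isometries
      (∀ (P Q : QPMet.{u}) (f : P.carrier → Q.carrier), IsQuasiIsometry f →
        Metric.hausdorffEDist (f '' P.sub) Q.sub ≠ ⊤ →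
        ∃ hf : QPMet.IsMorphism P Q f,
          Function.Bijective (endsMap E hE (P := P) (Q := Q) ⟨f, hf⟩)) ∧
      -- the usual ends of a proper geodesic space
      (∀ (X : Type u) [MetricSpace X] [ProperSpace X], IsGeodesicSpace X →
        ∀ C : Set X, C.Nonempty → IsCompact C →
        ∃ Φ : FilteredEnds C ≃ RayEnds X,
          ∀ (σ : ℝ≥0) (A : EndsAtScale C σ) (ρ : ProperRay X),
            Φ (FilteredEnds.mk A) = RayEnds.mk ρ ↔
              ∀ μ : ℝ≥0, ∀ᶠ t in Filter.atTop, ρ.toFun t ∈ A.comp μ) ∧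
      -- coends of a finitely generated subgroup
      (∀ (G : Type u) [Group G] (S : Set G) (hS : Subgroup.closure S = ⊤), S.Finite →
        ∀ P : Subgroup G, P.FG →
          Cardinal.mk (FilteredEnds (CayleySpace.vertex S hS '' (P : Set G))) =
            Cardinal.mk (Coends S hS P)) := by
  refine ⟨QPMet.endsFunctor, fun _ => rfl, fun P Q f σ A => ?_, fun P f r h e => ?_,
    fun P Q f hf hH => ?_, fun X _ _ hX C hne hC => exists_equiv_rayEnds hX hne hC,
    fun G _ S hS hfin P hP => ?_⟩
  · obtain ⟨τ, B, hB⟩ := QPMet.IsMorphism.exists_mapsTo (QPMet.Hom.isMorphism f) A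
    exact ⟨τ, B, QPMet.Hom.endsFun_mk f hB, hB⟩
  · exact (QPMet.Hom.endsFun_eq_of_dist_le f (𝟙 P) h e).trans (QPMet.Hom.endsFun_id e)
  · obtain ⟨hf, g, r, hg, hgf, hfg⟩ := QPMet.exists_quasiInverse hf hH
    exact ⟨hf, QPMet.Hom.bijective_endsFun ⟨f, hf⟩ ⟨g, hg⟩ hgf hfg⟩
  · obtain ⟨Φ⟩ := nonempty_filteredEnds_equiv_coends (hS := hS) hfin hP
    exact Cardinal.mk_congr Φ
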